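/- Let $\Bbbk$ be any field and let $\mathcal T=\{1,2,3,4\}$ be the rack of the four $3$-cycles $\pi_1=(2\,3\,4)$, $\pi_2=(1\,4\,3)$, $\pi_3=(1\,2\,4)$, $\pi_4=(1\,3\,2)$ in $\mathbb A_4$ under conjugation, $\pi_{i\triangleright j}=\pi_i\pi_j\pi_i^{-1}$, where permutations are multiplied from left to right (so $i\triangleright j=\pi_i^{-1}(j)$ as a function; e.g. $1\triangleright 2=4$, $1\triangleright 4=3$, $1\triangleright 3=2$). Let $G=G_{\mathcal T}=\langle x_1,x_2,x_3,x_4\mid x_ix_jx_i^{-1}=x_{i\triangleright j}\rangle$ be its enveloping group; in $G$ one has $x_1x_2=x_4x_1=x_2x_4$, $x_1x_4=x_3x_1=x_4x_3$, $x_1x_3=x_2x_1=x_3x_2$, $x_2x_3=x_4x_2=x_3x_4$, and $x_4x_2$ commutes with $x_1$. Let $\rho$ be a representation over $\Bbbk$ of the centralizer $C_G(x_1)$ that is absolutely simple (i.e. $K\otimes_\Bbbk\rho$ is simple for every field extension $K/\Bbbk$). Let $V=M(x_1,\rho)=\mathrm{Ind}_{C_G(x_1)}^G\rho$ be the Yetter–Drinfeld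 module over $\Bbbk G$ with coaction $h\otimes w\mapsto hx_1h^{-1}\otimes(h\otimes w)$, let $d_V=\dim V$, and let $V_g=\{v\in V\mid\delta(v)=g\otimes v\}$. Let $\mathfrak B(V)=\bigoplus_n\mathfrak B_n(V)$ be the Nichols algebra of $V$, that is, the quotient of the braided tensor algebra $T(V)$ by the largest homogeneous ideal and coideal contained in $\bigoplus_{n\ge2}V^{\otimes n}$, with Hilbert series $\mathcal H_{\mathfrak B(V)}(t)=\sum_n\dim\mathfrak B_n(V)\,t^n$, and write $(n)_t=1+t+\dots+t^{n-1}$. By an integral we mean a nonzero $\Lambda\in\mathfrak B(V)$ with $x\Lambda=\Lambda x=\varepsilon(x)\Lambda$ for all $x\in\mathfrak B(V)$. 1. $\rho$ is a linear character (it is one-dimensional), hence $d_V=4$. Moreover, $\dim\mathfrak B_2(V)\le d_V(d_V+1)/2$ if and only if $\rho(x_1)=-1$ and $\rho(x_4x_2)=1$. 2. Assume that $\mathrm{char}\,\Bbbk\neq2$, $\rho(x_1)=-1$ and $\rho(x_4x_2)=1$. Then $\mathcal H_{\mathfrak B(V)}(t)=(2)_t^2(3)_t(6)_t$ and $\dim\mathfrak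 B(V)=72$; and for any nonzero $v_i\in V_{x_i}$, $i\in\{1,2,3,4\}$, the monomial $v_1v_2v_1v_4v_2v_1v_4v_2v_3$ is an integral of $\mathfrak B(V)$. 3. Assume that $\mathrm{char}\,\Bbbk=2$, $\rho(x_1)=-1$ and $\rho(x_4x_2)=1$. Then $\mathcal H_{\mathfrak B(V)}(t)=(2)_t^2(3)_t^2$ and $\dim\mathfrak B(V)=36$; and for any nonzero $v_i\in V_{x_i}$, $i\in\{1,2,3,4\}$, the monomial $v_1v_2v_1v_4v_2v_3$ is an integral of $\mathfrak B(V)$. -/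

import Mathlib

open scoped TensorProduct Quandles

universe u v w

/-! ### Absolutely simple representations -/

/-- Extension of scalars `K ⊗ W` of a representation of a group along a field extension `K / k`. -/
noncomputable def Representation.extendScalars {k : Type u} {G : Type v} {W : Type w} [Field k]
    [Group G] [AddCommGroup W] [Module k W] (K : Type u) [Field K] [Algebra k K]
    (ρ : Representation k G W) : Representation K G (K ⊗[k] W) where
  toFun g := (ρ g).baseChange K
  map_one' := by ext; simp
  map_mul' g h := by ext; simp

/-- A representation over `k` is absolutely simple if all its extensions of scalars to fields
containing `k` (in particular, the representation itself) are simple. -/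
def Representation.IsAbsolutelySimple {k : Type u} {G : Type v} {W : Type w} [Field k]
    [Group G] [AddCommGroup W] [Module k W] (ρ : Representation k G W) : Prop :=
  ∀ (K : Type u) [Field K] [Algebra k K], (ρ.extendScalars K).IsIrreducible

/-! ### Yetter-Drinfeld modules over group algebras -/

/-- A Yetter-Drinfeld module structure on `V` over the group algebra `kG`.  The left coaction
`V → kG ⊗ V` is written in the form `V → (G →₀ V)`, where `∑ g ⊗ v_g` is the finitely supported
function `g ↦ v_g`. -/
structure YetterDrinfeld (k : Type u) (G : Type v) (V : Type w) [Field k] [Group G]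
    [AddCommGroup V] [Module k V] where
  /-- the action of `G` -/
  action : Representation k G V
  /-- the coaction of `kG` -/
  coaction : V →ₗ[k] (G →₀ V)
  counit_coaction : ∀ v, ((coaction v).sum fun _ u => u) = v
  coassoc : ∀ v g, coaction (coaction v g) = Finsupp.single g (coaction v g)
  compat : ∀ h v g, coaction (action h v) (h * g * h⁻¹) = action h (coaction v g)

namespace YetterDrinfeld

variable {k : Type u} {G : Type v} {V : Type w} [Field k] [Group G] [AddCommGroup V] [Module k V]
  (Y : YetterDrinfeld k G V)

/-- The subspace `V_g = {v | δ v = g ⊗ v}`. -/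
def component (g : G) : Submodule k V where
  carrier := {v | Y.coaction v = Finsupp.single g v}
  add_mem' := fun {a b} ha hb => by
    simp only [Set.mem_ofPred_eq] at *
    rw [map_add, ha, hb, Finsupp.single_add]
  zero_mem' := by simp
  smul_mem' := fun c a ha => by
    simp only [Set.mem_ofPred_eq] at *
    rw [map_smul, ha, Finsupp.smul_single]

/-! ### The braided coproduct of the tensor algebra -/

/-- The (diagonal) action of `g : G` on the tensor algebra `T(V)`. -/
noncomputable def tensorAction (g : G) : TensorAlgebra k V →ₐ[k] TensorAlgebra k V :=
  TensorAlgebra.lift k (TensorAlgebra.ι k ∘ₗ Y.action g)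

/-- For `v : V`, the left multiplication by `v ⊗ 1 + 1 ⊗ v` on the braided tensor product algebra
`T(V) ⊗ T(V)`, that is, the operator
`a ⊗ b ↦ v a ⊗ b + ∑ (g · a) ⊗ (v_g b)`, where `δ v = ∑ g ⊗ v_g`. -/
noncomputable def primitiveMul :
    V →ₗ[k] Module.End k (TensorAlgebra k V ⊗[k] TensorAlgebra k V) :=
  (LinearMap.rTensorHom (TensorAlgebra k V) ∘ₗ
      LinearMap.mul k (TensorAlgebra k V) ∘ₗ TensorAlgebra.ι k) +
    (Finsupp.lsum k fun g =>
      (TensorProduct.mapBilinear (.id k) (TensorAlgebra k V) (TensorAlgebra k V)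
          (TensorAlgebra k V) (TensorAlgebra k V) (Y.tensorAction g).toLinearMap) ∘ₗ
        LinearMap.mul k (TensorAlgebra k V) ∘ₗ TensorAlgebra.ι k) ∘ₗ Y.coaction

/-- The coproduct of the tensor algebra `T(V)`: the unique algebra map from `T(V)` to the braided
tensor product algebra `T(V) ⊗ T(V)` with `Δ v = v ⊗ 1 + 1 ⊗ v` for `v : V`.  It is determined by
`Δ 1 = 1 ⊗ 1` and `Δ (v x) = (v ⊗ 1 + 1 ⊗ v) Δ x`. -/
noncomputable def comul :
    TensorAlgebra k V →ₗ[k] TensorAlgebra k V ⊗[k] TensorAlgebra k V :=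
  (LinearMap.applyₗ (1 ⊗ₜ[k] 1)) ∘ₗ (TensorAlgebra.lift k Y.primitiveMul).toLinearMap

theorem comul_one : Y.comul 1 = 1 ⊗ₜ[k] 1 := by simp [comul]

theorem comul_ι_mul (v : V) (x : TensorAlgebra k V) :
    Y.comul (TensorAlgebra.ι k v * x) = Y.primitiveMul v (Y.comul x) := by simp [comul]

theorem primitiveMul_tmul (v : V) (a b : TensorAlgebra k V) :
    Y.primitiveMul v (a ⊗ₜ[k] b) = (TensorAlgebra.ι k v * a) ⊗ₜ[k] b +
      (Y.coaction v).sum fun g u => Y.tensorAction g a ⊗ₜ[k] (TensorAlgebra.ι k u * b) := by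
  simp [primitiveMul, Finsupp.sum, LinearMap.sum_apply]

/-! ### The Nichols algebra -/

/-- The degree `n` part `V^{⊗ n}` of the tensor algebra. -/
noncomputable abbrev tensorPart (k : Type u) (V : Type w) [Field k] [AddCommGroup V] [Module k V]
    (n : ℕ) : Submodule k (TensorAlgebra k V) :=
  LinearMap.range (TensorAlgebra.ι k : V →ₗ[k] TensorAlgebra k V) ^ n

/-- Homogeneous two-sided ideals of `T(V)` contained in `⨁_{n ≥ 2} V^{⊗ n}` which are coideals. -/
structure IsHomogeneousBiideal (I : Ideal (TensorAlgebra k V)) : Prop where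
  isTwoSided : I.IsTwoSided
  isHomogeneous : I.IsHomogeneous (tensorPart k V)
  degree_ge_two : ∀ x ∈ I, ∀ n < 2,
    (DirectSum.decompose (tensorPart k V) x n : TensorAlgebra k V) = 0
  isCoideal : ∀ x ∈ I, Y.comul x ∈
    LinearMap.range (TensorProduct.map (I.restrictScalars k).subtype
      (LinearMap.id : TensorAlgebra k V →ₗ[k] TensorAlgebra k V)) ⊔
    LinearMap.range (TensorProduct.map
      (LinearMap.id : TensorAlgebra k V →ₗ[k] TensorAlgebra k V) (I.restrictScalars k).subtype)

/-- The defining ideal of the Nichols algebra: the largest homogeneous ideal and coideal of `T(V)`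
contained in `⨁_{n ≥ 2} V^{⊗ n}` (the sum of all such). -/
noncomputable def nicholsIdeal : Ideal (TensorAlgebra k V) :=
  sSup {I | Y.IsHomogeneousBiideal I}

instance : Y.nicholsIdeal.IsTwoSided where
  mul_mem_of_left {a} b ha := by
    unfold nicholsIdeal at *
    rw [sSup_eq_iSup'] at *
    induction ha using Submodule.iSup_induction' with
    | mem I x hx =>
      have := I.2.isTwoSided
      exact Submodule.mem_iSup_of_mem I (Ideal.mul_mem_right b I.1 hx)
    | zero => simp
    | add x y _ _ hx hy => rw [add_mul]; exact add_mem hx hy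

/-- The Nichols algebra `𝔅(V)`. -/
abbrev NicholsAlgebra : Type _ := TensorAlgebra k V ⧸ Y.nicholsIdeal

/-- The canonical map `V → 𝔅(V)`. -/
noncomputable def nicholsι : V →ₗ[k] Y.NicholsAlgebra :=
  (Ideal.Quotient.mkₐ k Y.nicholsIdeal).toLinearMap ∘ₗ TensorAlgebra.ι k

/-- The product `v_{i₁} v_{i₂} ⋯ v_{i_r}` in `𝔅(V)`, for `l = [i₁, …, i_r]`. -/
noncomputable def nicholsMonomial {ι : Type*} (v : ι → V) (l : List ι) : Y.NicholsAlgebra :=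
  (l.map fun i => Y.nicholsι (v i)).prod

/-- The homogeneous subspace `𝔅_n(V)` of degree `n`. -/
noncomputable def nicholsPart (n : ℕ) : Submodule k Y.NicholsAlgebra :=
  (tensorPart k V n).map (Ideal.Quotient.mkₐ k Y.nicholsIdeal).toLinearMap

/-- The Hilbert series `∑ dim 𝔅_n(V) t^n` (for a finite-dimensional `V`). -/
noncomputable def hilbertSeries : PowerSeries ℕ :=
  PowerSeries.mk fun n => Module.finrank k (Y.nicholsPart n)

theorem algebraMapInv_eq_zero_of_mem_tensorPart {n : ℕ} (hn : n ≠ 0) {x : TensorAlgebra k V}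
    (hx : x ∈ tensorPart k V n) : TensorAlgebra.algebraMapInv x = 0 := by
  obtain ⟨m, rfl⟩ := Nat.exists_eq_succ_of_ne_zero hn
  rw [tensorPart, pow_succ] at hx
  induction hx using Submodule.mul_induction_on' with
  | mem_mul_mem a _ b hb =>
    obtain ⟨v, rfl⟩ := hb
    simp [TensorAlgebra.algebraMapInv]
  | add a _ b _ ha hb => rw [map_add, ha, hb, add_zero]

theorem algebraMapInv_eq_zero_of_mem_nicholsIdeal (x : TensorAlgebra k V)
    (hx : x ∈ Y.nicholsIdeal) : TensorAlgebra.algebraMapInv x = 0 := by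
  unfold nicholsIdeal at hx
  rw [sSup_eq_iSup'] at hx
  induction hx using Submodule.iSup_induction' with
  | mem I x hx =>
    classical
    rw [← DirectSum.sum_support_decompose (tensorPart k V) x, map_sum]
    refine Finset.sum_eq_zero fun n _ => ?_
    by_cases hn : n = 0
    · rw [I.2.degree_ge_two x hx n (by omega), map_zero]
    · exact algebraMapInv_eq_zero_of_mem_tensorPart hn (SetLike.coe_mem _)
  | zero => simp
  | add x y _ _ hx hy => rw [map_add, hx, hy, add_zero]

/-- The counit of the Nichols algebra. -/
noncomputable def nicholsCounit : Y.NicholsAlgebra →ₐ[k] k :=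
  Ideal.Quotient.liftₐ Y.nicholsIdeal TensorAlgebra.algebraMapInv
    Y.algebraMapInv_eq_zero_of_mem_nicholsIdeal

/-- A (nonzero, two-sided) integral of the Nichols algebra. -/
def IsIntegral (Λ : Y.NicholsAlgebra) : Prop :=
  Λ ≠ 0 ∧ ∀ x : Y.NicholsAlgebra,
    x * Λ = Y.nicholsCounit x • Λ ∧ Λ * x = Y.nicholsCounit x • Λ

/-! ### The induced Yetter-Drinfeld modules `M(g, ρ)` -/

/-- The underlying space `kG ⊗_{kC} W`, `C = C_G(g)`, of `M(g, ρ)`.  In Mathlib's model of the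
induced representation the class `IndV.mk _ _ h w` stands for `h⁻¹ ⊗ w`. -/
abbrev InducedSpace {W : Type w} [AddCommGroup W] [Module k W] (g : G)
    (ρ : Representation k (Subgroup.centralizer {g}) W) : Type _ :=
  Representation.IndV (Subgroup.centralizer {g}).subtype ρ

/-- The coaction of `M(g, ρ)`, with `h ⊗ w ↦ h g h⁻¹ ⊗ (h ⊗ w)`. -/
noncomputable def inducedCoaction {W : Type w} [AddCommGroup W] [Module k W] (g : G)
    (ρ : Representation k (Subgroup.centralizer {g}) W) :
    InducedSpace g ρ →ₗ[k] (G →₀ InducedSpace g ρ) :=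
  Representation.Coinvariants.lift _
    (TensorProduct.lift ((Finsupp.lsum k fun h : G => LinearMap.toSpanSingleton k _
        (Finsupp.lsingle (h⁻¹ * g * h) ∘ₗ
          Representation.IndV.mk (Subgroup.centralizer {g}).subtype ρ h)) ∘ₗ
      (MonoidAlgebra.coeffLinearEquiv k).toLinearMap))
    (fun c => by
      ext h w : 4
      have hc : g * (c : G) = c * g :=
        Subgroup.mem_centralizer_iff.1 c.2 g (Set.mem_singleton g)
      have hd : ((c : G) * h)⁻¹ * g * (c * h) = h⁻¹ * g * h := by
        rw [mul_inv_rev]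
        calc h⁻¹ * (c : G)⁻¹ * g * (c * h) = h⁻¹ * ((c : G)⁻¹ * (g * c)) * h := by group
          _ = h⁻¹ * g * h := by rw [hc]; group
      have hw : Representation.IndV.mk (Subgroup.centralizer {g}).subtype ρ (c * h) (ρ c w) =
          Representation.IndV.mk (Subgroup.centralizer {g}).subtype ρ h w := by
        have := Representation.Coinvariants.mk_self_apply (Representation.tprod
          ((Representation.leftRegular k G).comp (Subgroup.centralizer {g}).subtype) ρ) c
          ((MonoidAlgebra.single h 1) ⊗ₜ w)
        simpa using this
      simp at hw ⊢
      rw [mul_inv_rev] at hd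
      rw [hd, hw])

/-- The element `h ⊗ w` of `kG ⊗_{kC} W`. -/
noncomputable def inducedMk {W : Type w} [AddCommGroup W] [Module k W] (g : G)
    (ρ : Representation k (Subgroup.centralizer {g}) W) (h : G) : W →ₗ[k] InducedSpace g ρ :=
  Representation.IndV.mk (Subgroup.centralizer {g}).subtype ρ h⁻¹

theorem induced_hom_ext {W U : Type*} [AddCommGroup W] [Module k W] [AddCommGroup U] [Module k U]
    (g : G) (ρ : Representation k (Subgroup.centralizer {g}) W) {f₁ f₂ : InducedSpace g ρ →ₗ[k] U}
    (h : ∀ t w, f₁ (inducedMk g ρ t w) = f₂ (inducedMk g ρ t w)) : f₁ = f₂ :=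
  Representation.IndV.hom_ext _ _ fun t => LinearMap.ext fun w => by
    simpa [inducedMk] using h t⁻¹ w

theorem ind_inducedMk {W : Type w} [AddCommGroup W] [Module k W] (g : G)
    (ρ : Representation k (Subgroup.centralizer {g}) W) (t h : G) (w : W) :
    Representation.ind (Subgroup.centralizer {g}).subtype ρ t (inducedMk g ρ h w) =
      inducedMk g ρ (t * h) w := by
  simp [inducedMk]

theorem inducedCoaction_mk {W : Type w} [AddCommGroup W] [Module k W] (g : G)
    (ρ : Representation k (Subgroup.centralizer {g}) W) (h : G) (w : W) :
    inducedCoaction g ρ (inducedMk g ρ h w) =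
      Finsupp.single (h * g * h⁻¹) (inducedMk g ρ h w) := by
  simp [inducedCoaction, inducedMk]

/-- The Yetter-Drinfeld module `M(g, ρ)`: the induced representation `Ind_{C_G(g)}^G ρ` with the
coaction `h ⊗ w ↦ h g h⁻¹ ⊗ (h ⊗ w)`. -/
noncomputable def induced {W : Type w} [AddCommGroup W] [Module k W] (g : G)
    (ρ : Representation k (Subgroup.centralizer {g}) W) :
    YetterDrinfeld k G (InducedSpace g ρ) where
  action := Representation.ind (Subgroup.centralizer {g}).subtype ρ
  coaction := inducedCoaction g ρ
  counit_coaction v := by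
    have : (Finsupp.lsum k fun _ : G => LinearMap.id (M := InducedSpace g ρ)) ∘ₗ
        inducedCoaction g ρ = LinearMap.id := by
      refine induced_hom_ext g ρ fun h w => ?_
      simp [inducedCoaction_mk]
    exact LinearMap.congr_fun this v
  coassoc v t := by
    have : inducedCoaction g ρ ∘ₗ Finsupp.lapply t ∘ₗ inducedCoaction g ρ =
        Finsupp.lsingle t ∘ₗ Finsupp.lapply t ∘ₗ inducedCoaction g ρ := by
      refine induced_hom_ext g ρ fun h w => ?_
      simp only [LinearMap.comp_apply, inducedCoaction_mk, Finsupp.lapply_apply, Finsupp.lsingle_apply]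
      by_cases ht : h * g * h⁻¹ = t
      · subst ht
        simp only [Finsupp.single_eq_same, inducedCoaction_mk]
      · simp only [Finsupp.single_eq_of_ne (Ne.symm ht), map_zero, Finsupp.single_zero]
    exact LinearMap.congr_fun this v
  compat t v s := by
    have : Finsupp.lapply (t * s * t⁻¹) ∘ₗ inducedCoaction g ρ ∘ₗ
          Representation.ind (Subgroup.centralizer {g}).subtype ρ t =
        Representation.ind (Subgroup.centralizer {g}).subtype ρ t ∘ₗ Finsupp.lapply s ∘ₗ
          inducedCoaction g ρ := by
      refine induced_hom_ext g ρ fun h w => ?_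
      have e : t * h * g * (t * h)⁻¹ = t * (h * g * h⁻¹) * t⁻¹ := by group
      simp only [LinearMap.comp_apply,
        ind_inducedMk, inducedCoaction_mk, Finsupp.lapply_apply, e]
      by_cases hs : h * g * h⁻¹ = s
      · subst hs
        simp only [Finsupp.single_eq_same, ind_inducedMk]
      · rw [Finsupp.single_eq_of_ne (Ne.symm hs),
          Finsupp.single_eq_of_ne (by simpa using Ne.symm hs), map_zero]
    exact LinearMap.congr_fun this v

end YetterDrinfeld

/-! ### The rack of the vertices of the tetrahedron -/

/-- The four elements of the rack `𝒯`. -/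
inductive Tetra : Type
  | p1 | p2 | p3 | p4
  deriving DecidableEq

namespace Tetra

instance : Fintype Tetra := ⟨{p1, p2, p3, p4}, by intro i; cases i <;> decide⟩

/-- The conjugacy class of the `3`-cycle `(2 3 4)` in the alternating group, labelled by
`π₁ = (2 3 4)`, `π₂ = (1 4 3)`, `π₃ = (1 2 4)`, `π₄ = (1 3 2)`. -/
def perm : Tetra → Equiv.Perm Tetra
  | p1 => c[p2, p3, p4]
  | p2 => c[p1, p4, p3]
  | p3 => c[p1, p2, p4]
  | p4 => c[p1, p3, p2]

/-- The rack structure is conjugation, `π_{i ▷ j} = π_i π_j π_i⁻¹`, where permutations are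
multiplied from left to right; equivalently, `i ▷ j` is the preimage of `j` under `π_i`. -/
instance : Rack Tetra where
  act i j := (perm i)⁻¹ j
  self_distrib := by decide
  invAct i j := perm i j
  left_inv i j := by simp
  right_inv i j := by simp

/-- In Mathlib, permutations are multiplied from right to left. -/
theorem perm_act (i j : Tetra) : perm (i ◃ j) = (perm i)⁻¹ * perm j * perm i := by
  revert i j; decide

/-- The enveloping group `G_X` of `X = 𝒯`. -/
abbrev EnvGroup : Type := Rack.EnvelGroup Tetra

/-- The generators `x_i` of the enveloping group. -/
def x (i : Tetra) : EnvGroup := Rack.toEnvelGroup Tetra i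

/-- The centralizer of `x₁` in the enveloping group. -/
abbrev C : Subgroup EnvGroup := Subgroup.centralizer {x p1}

theorem x_mul_x (i j : Tetra) : x i * x j = x (i ◃ j) * x i := by
  have h : x (i ◃ j) = x i * x j * (x i)⁻¹ := (Rack.toEnvelGroup Tetra).map_act
  rw [h, inv_mul_cancel_right]

theorem x1_mem_C : x p1 ∈ C := by
  simp [Subgroup.mem_centralizer_iff]

theorem x4_mul_x2_mem_C : x p4 * x p2 ∈ C := by
  simp only [Subgroup.mem_centralizer_iff, Set.mem_singleton_iff, forall_eq]
  have h14 : x p1 * x p4 = x p3 * x p1 := x_mul_x p1 p4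
  have h12 : x p1 * x p2 = x p4 * x p1 := x_mul_x p1 p2
  have h34 : x p3 * x p4 = x p2 * x p3 := x_mul_x p3 p4
  have h42 : x p4 * x p2 = x p3 * x p4 := x_mul_x p4 p2
  rw [← mul_assoc, h14, mul_assoc, h12, ← mul_assoc, h42]

/-- `x₁` as an element of its centralizer. -/
def x1 : C := ⟨x p1, x1_mem_C⟩

/-- `x₄ x₂` as an element of the centralizer of `x₁`. -/
def x4x2 : C := ⟨x p4 * x p2, x4_mul_x2_mem_C⟩

/-- The space `V = M(x₁, ρ)`. -/
abbrev V {k : Type u} [Field k] {W : Type w} [AddCommGroup W] [Module k W]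
    (ρ : Representation k C W) : Type _ :=
  YetterDrinfeld.InducedSpace (x p1) ρ

/-- The Yetter-Drinfeld module structure of `V = M(x₁, ρ)`. -/
noncomputable abbrev M {k : Type u} [Field k] {W : Type w} [AddCommGroup W] [Module k W]
    (ρ : Representation k C W) : YetterDrinfeld k EnvGroup (V ρ) :=
  YetterDrinfeld.induced (x p1) ρ

end Tetra

/-- The polynomial `(n)_t = 1 + t + ⋯ + t^{n-1}`, as a power series. -/
noncomputable def tNumber (n : ℕ) : PowerSeries ℕ := ∑ i ∈ Finset.range n, PowerSeries.X ^ i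

namespace YetterDrinfeld

variable {k : Type u} {G : Type v} {V : Type w} [Field k] [Group G] [AddCommGroup V] [Module k V]
  (Y : YetterDrinfeld k G V)

/-! ### Homogeneous vectors -/

/-! The proof rests on skew derivations ∂_f = (id ⊗ f)Δ. The defining ideal of 𝔅(V) consists of the
tensors that ε annihilates after every sequence of skew derivations along homogeneous forms
(`nicholsIdeal_eq`). Skew derivations therefore descend to 𝔅(V), and an element of counit zero
killed by all of them is zero (`nicholsAlgebra_eq_zero`). Relations can thus be checked by
differentiating, and linear independence by exhibiting differential operators.

The centralizer of x₁ is generated by the commuting elements x₁ and x₄x₂ (`genC_eq_top`), so an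
absolutely simple ρ is a character and V has a homogeneous basis indexed by the rack. If ρ(x₁) = -1
and ρ(x₄x₂) = 1, a change of signs makes x_i act by e_j ↦ -e_{i▷j}. Then 𝔅(V) is a `SkewAlgebra`,
and everything further is computed there. It satisfies v_i² = 0, four cyclic quadratic relations, a
cyclic relation of degree 6 (`sextic_relation`), and in characteristic 2 a cyclic relation of degree
3 (`cubic_relation`).

Upper bound (`span_basisWord`): with R generated by v₁, v₂, v₄, the quadratic relations give 𝔅 = R +
R v₃. Moreover R is spanned by the products of one of six words in v₁, v₂ with one of the first n
prefixes of v₄v₂v₁v₄v₂. Here n = 6 works always and n = 3 in characteristic 2. Lower bound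
(`linearIndependent_basisWord`): operators built from D₃, D₄ and `cubicD` pass through words in v₁,
v₂ and detect the prefix, with value ±1 for prefixes of length at most 2 and ±2 beyond. This is
where the characteristic enters. The resulting 12n monomials are a homogeneous basis. The only
longest one lies in the top degree, so it is an integral.

In degree two, independence of products is governed by the braided symmetrizer 1 + c, and the pairs
(i, j) split into orbits of (i, j) ↦ (i▷j, i): four fixed pairs and four 3-cycles. If ρ(x₁) ≠ -1 the
dimension is at least 12; if ρ(x₁) = -1 but ρ(x₄x₂) ≠ 1 it is at least 11; otherwise the Hilbert
series gives 8. -/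

theorem coaction_apply_mem (v : V) (g : G) : Y.coaction v g ∈ Y.component g :=
  Y.coassoc v g

variable {Y} in
theorem action_mem_component {g : G} {v : V} (hv : v ∈ Y.component g) (h : G) :
    Y.action h v ∈ Y.component (h * g * h⁻¹) := by
  have hv' : Y.coaction v = Finsupp.single g v := hv
  change Y.coaction (Y.action h v) = Finsupp.single (h * g * h⁻¹) (Y.action h v)
  ext s
  have e := Y.compat h v (h⁻¹ * s * h)
  rw [show h * (h⁻¹ * s * h) * h⁻¹ = s by group, hv'] at e
  rw [e]
  by_cases hs : h⁻¹ * s * h = g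
  · have : s = h * g * h⁻¹ := by rw [← hs]; group
    rw [this, show h⁻¹ * (h * g * h⁻¹) * h = g by group]
    simp
  · have : s ≠ h * g * h⁻¹ := fun e => hs (by rw [e]; group)
    rw [Finsupp.single_eq_of_ne hs, Finsupp.single_eq_of_ne this, map_zero]

/-- An induction principle for the tensor algebra of a Yetter-Drinfeld module: multiplication from
the left by homogeneous vectors. -/
theorem induction_left {P : TensorAlgebra k V → Prop} (one : P 1)
    (add : ∀ x y, P x → P y → P (x + y)) (smul : ∀ (c : k) x, P x → P (c • x))
    (mul : ∀ g, ∀ v ∈ Y.component g, ∀ x, P x → P (TensorAlgebra.ι k v * x))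
    (x : TensorAlgebra k V) : P x := by
  have zero : P 0 := by simpa using smul 0 1 one
  have key : ∀ x y : TensorAlgebra k V, P y → P (x * y) := by
    intro x
    induction x using TensorAlgebra.induction with
    | algebraMap r => intro y hy; rw [← Algebra.smul_def]; exact smul r y hy
    | ι v =>
      intro y hy
      rw [← Y.counit_coaction v, Finsupp.sum, map_sum, Finset.sum_mul]
      exact Finset.sum_induction _ P add zero fun g _ => mul g _ (Y.coaction_apply_mem v g) y hy
    | mul a b ha hb => intro y hy; rw [mul_assoc]; exact ha _ (hb _ hy)
    | add a b ha hb => intro y hy; rw [add_mul]; exact add _ _ (ha _ hy) (hb _ hy)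
  simpa using key x 1 one

/-! ### The action on the tensor algebra and the coproduct -/

@[simp]
theorem tensorAction_ι (g : G) (v : V) :
    Y.tensorAction g (TensorAlgebra.ι k v) = TensorAlgebra.ι k (Y.action g v) := by
  simp [tensorAction]

theorem tensorAction_mul (g h : G) (x : TensorAlgebra k V) :
    Y.tensorAction (g * h) x = Y.tensorAction g (Y.tensorAction h x) := by
  have : Y.tensorAction (g * h) = (Y.tensorAction g).comp (Y.tensorAction h) := by
    ext v; simp
  rw [this]; rfl

@[simp]
theorem algebraMapInv_tensorAction (g : G) (x : TensorAlgebra k V) :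
    TensorAlgebra.algebraMapInv (Y.tensorAction g x) = TensorAlgebra.algebraMapInv x := by
  have : (TensorAlgebra.algebraMapInv.comp (Y.tensorAction g) : TensorAlgebra k V →ₐ[k] k) =
      TensorAlgebra.algebraMapInv := by ext v; simp [TensorAlgebra.algebraMapInv]
  exact DFunLike.congr_fun this x

theorem tensorAction_mem_tensorPart (g : G) {n : ℕ} {x : TensorAlgebra k V}
    (hx : x ∈ tensorPart k V n) : Y.tensorAction g x ∈ tensorPart k V n := by
  have h : (tensorPart k V n).map (Y.tensorAction g).toLinearMap ≤ tensorPart k V n := by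
    rw [tensorPart, Submodule.map_pow]
    refine pow_le_pow_left' ?_ n
    rintro _ ⟨_, ⟨v, rfl⟩, rfl⟩
    exact ⟨Y.action g v, by simp⟩
  exact h ⟨x, hx, rfl⟩

variable {Y} in
theorem primitiveMul_of_mem {g : G} {v : V} (hv : v ∈ Y.component g) :
    Y.primitiveMul v = TensorProduct.map (LinearMap.mulLeft k (TensorAlgebra.ι k v)) LinearMap.id +
      TensorProduct.map (Y.tensorAction g).toLinearMap
        (LinearMap.mulLeft k (TensorAlgebra.ι k v)) := by
  have hv' : Y.coaction v = Finsupp.single g v := hv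
  refine TensorProduct.ext' fun a b => ?_
  rw [primitiveMul_tmul, hv', Finsupp.sum_single_index (by simp)]
  simp

/-- The action of `g` on `T(V) ⊗ T(V)`. -/
noncomputable def tensorAction₂ (g : G) :
    TensorAlgebra k V ⊗[k] TensorAlgebra k V →ₗ[k] TensorAlgebra k V ⊗[k] TensorAlgebra k V :=
  TensorProduct.map (Y.tensorAction g).toLinearMap (Y.tensorAction g).toLinearMap

/-- Left multiplication by v ⊗ 1 + 1 ⊗ v is equivariant because (g h g⁻¹) g = g h, where h is the
degree of v. -/
theorem comul_tensorAction (g : G) (x : TensorAlgebra k V) :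
    Y.comul (Y.tensorAction g x) = Y.tensorAction₂ g (Y.comul x) := by
  induction x using Y.induction_left with
  | one => simp [comul_one, tensorAction₂]
  | add x y hx hy => simp [hx, hy]
  | smul c x hx => simp [hx]
  | mul h v hv x hx =>
    rw [map_mul, tensorAction_ι, comul_ι_mul, comul_ι_mul, hx]
    generalize Y.comul x = z
    rw [primitiveMul_of_mem hv, primitiveMul_of_mem (action_mem_component hv g)]
    induction z using TensorProduct.induction_on with
    | zero => simp
    | add y z hy hz => simp only [map_add, hy, hz]
    | tmul a b =>
      have : Y.tensorAction (g * h * g⁻¹) (Y.tensorAction g a) =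
          Y.tensorAction g (Y.tensorAction h a) := by
        rw [← tensorAction_mul, ← tensorAction_mul, inv_mul_cancel_right]
      simp [tensorAction₂, this]

/-! ### Skew derivations -/

/-- The linear form on `T(V)` which is `f` on `V` and zero in all degrees different from one. -/
noncomputable def degreeOne (f : Module.Dual k V) : TensorAlgebra k V →ₗ[k] k :=
  TrivSqZeroExt.sndHom k k ∘ₗ
    (TensorAlgebra.lift k (TrivSqZeroExt.inrHom k k ∘ₗ f)).toLinearMap

theorem fst_lift_inr (f : Module.Dual k V) (x : TensorAlgebra k V) :
    (TensorAlgebra.lift k (TrivSqZeroExt.inrHom k k ∘ₗ f) x).fst =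
      TensorAlgebra.algebraMapInv x := by
  have : (TrivSqZeroExt.fstHom k k k).comp
      (TensorAlgebra.lift k (TrivSqZeroExt.inrHom k k ∘ₗ f)) = TensorAlgebra.algebraMapInv := by
    ext v; simp [TensorAlgebra.algebraMapInv]
  exact DFunLike.congr_fun this x

@[simp]
theorem degreeOne_one (f : Module.Dual k V) : degreeOne f (1 : TensorAlgebra k V) = 0 := by
  simp [degreeOne]

@[simp]
theorem degreeOne_ι_mul (f : Module.Dual k V) (v : V) (x : TensorAlgebra k V) :
    degreeOne f (TensorAlgebra.ι k v * x) = f v * TensorAlgebra.algebraMapInv x := by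
  simp [degreeOne, fst_lift_inr]

theorem degreeOne_eq_zero_of_mem (f : Module.Dual k V) {n : ℕ} {x : TensorAlgebra k V}
    (hx : x ∈ tensorPart k V (n + 2)) : degreeOne f x = 0 := by
  rw [tensorPart, pow_succ'] at hx
  induction hx using Submodule.mul_induction_on' with
  | mem_mul_mem a ha b hb =>
    obtain ⟨v, rfl⟩ := ha
    rw [degreeOne_ι_mul, algebraMapInv_eq_zero_of_mem_tensorPart (Nat.succ_ne_zero n) hb,
      mul_zero]
  | add a _ b _ ha hb => rw [map_add, ha, hb, add_zero]

/-- The skew derivation `∂_f = (id ⊗ f) Δ` of `T(V)`, for a linear form `f` on `V`. -/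
noncomputable def skewDer (f : Module.Dual k V) : TensorAlgebra k V →ₗ[k] TensorAlgebra k V :=
  (TensorProduct.rid k _).toLinearMap ∘ₗ LinearMap.lTensor _ (degreeOne f) ∘ₗ Y.comul

theorem counit_comul (x : TensorAlgebra k V) :
    TensorProduct.rid k _ (LinearMap.lTensor _ TensorAlgebra.algebraMapInv.toLinearMap
      (Y.comul x)) = x := by
  induction x using Y.induction_left with
  | one => simp [comul_one]
  | add x y hx hy => simp only [map_add, hx, hy]
  | smul c x hx => simp only [map_smul, hx]
  | mul h v hv x hx =>
    rw [comul_ι_mul, primitiveMul_of_mem hv]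
    conv_rhs => rw [← hx]
    generalize Y.comul x = z
    induction z using TensorProduct.induction_on with
    | zero => simp
    | add y z hy hz => simp only [map_add, hy, hz, mul_add]
    | tmul a b => simp [TensorAlgebra.algebraMapInv]

@[simp]
theorem skewDer_one (f : Module.Dual k V) : Y.skewDer f 1 = 0 := by
  simp [skewDer, comul_one]

variable {Y} in
theorem skewDer_ι_mul (f : Module.Dual k V) {g : G} {v : V} (hv : v ∈ Y.component g)
    (x : TensorAlgebra k V) : Y.skewDer f (TensorAlgebra.ι k v * x) =
      TensorAlgebra.ι k v * Y.skewDer f x + f v • Y.tensorAction g x := by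
  simp only [skewDer, LinearMap.comp_apply, comul_ι_mul, primitiveMul_of_mem hv]
  -- Writing the bare x as (id ⊗ ε)Δx makes both sides linear in Δx, which can then be replaced by
  -- an arbitrary tensor.
  conv_rhs => rhs; rw [← Y.counit_comul x]
  generalize Y.comul x = z
  induction z using TensorProduct.induction_on with
  | zero => simp
  | add y z hy hz =>
    simp only [map_add, mul_add, smul_add] at *
    rw [hy, hz]; abel
  | tmul a b => simp [smul_smul]

@[simp]
theorem skewDer_ι (f : Module.Dual k V) (v : V) :
    Y.skewDer f (TensorAlgebra.ι k v) = algebraMap k _ (f v) := by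
  rw [← mul_one (TensorAlgebra.ι k v)]
  simp only [skewDer, LinearMap.comp_apply, comul_ι_mul, comul_one, primitiveMul_tmul]
  simp only [map_add, map_finsuppSum, LinearMap.lTensor_tmul, degreeOne_one, degreeOne_ι_mul]
  simp only [map_one, mul_one, TensorProduct.tmul_zero, map_zero, zero_add, LinearEquiv.coe_coe,
    TensorProduct.rid_tmul, Algebra.algebraMap_eq_smul_one]
  conv_rhs => rw [← Y.counit_coaction v]
  rw [map_finsuppSum, Finsupp.sum, Finsupp.sum, Finset.sum_smul]

theorem skewDer_tensorAction (f : Module.Dual k V) (g : G) (x : TensorAlgebra k V) :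
    Y.skewDer f (Y.tensorAction g x) = Y.tensorAction g (Y.skewDer (f ∘ₗ Y.action g) x) := by
  induction x using Y.induction_left with
  | one => simp
  | add x y hx hy => simp only [map_add, hx, hy]
  | smul c x hx => simp only [map_smul, hx]
  | mul h v hv x hx =>
    have : Y.tensorAction (g * h * g⁻¹) (Y.tensorAction g x) =
        Y.tensorAction g (Y.tensorAction h x) := by
      rw [← tensorAction_mul, ← tensorAction_mul, inv_mul_cancel_right]
    rw [map_mul, tensorAction_ι, skewDer_ι_mul f (action_mem_component hv g), skewDer_ι_mul _ hv,
      hx, this]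
    simp

/-- A form of coassociativity, proved without coassociativity of Δ itself: it is what makes the
radical a coideal. -/
theorem comul_skewDer (f : Module.Dual k V) (x : TensorAlgebra k V) :
    Y.comul (Y.skewDer f x) = LinearMap.lTensor _ (Y.skewDer f) (Y.comul x) := by
  induction x using Y.induction_left with
  | one => simp [comul_one]
  | add x y hx hy => simp only [map_add, hx, hy]
  | smul c x hx => simp only [map_smul, hx]
  | mul h v hv x hx =>
    rw [skewDer_ι_mul f hv, map_add, comul_ι_mul, comul_ι_mul, hx, map_smul, comul_tensorAction,
      primitiveMul_of_mem hv]
    generalize Y.comul x = z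
    induction z using TensorProduct.induction_on with
    | zero => simp
    | add y z hy hz =>
      simp only [map_add, smul_add, LinearMap.add_apply] at *
      rw [← hy, ← hz]; abel
    | tmul a b =>
      simp [tensorAction₂, skewDer_ι_mul f hv, TensorProduct.tmul_add, add_assoc]

theorem skewDer_mem_tensorPart (f : Module.Dual k V) {n : ℕ} {x : TensorAlgebra k V}
    (hx : x ∈ tensorPart k V (n + 1)) : Y.skewDer f x ∈ tensorPart k V n := by
  induction n generalizing x with
  | zero =>
    simp only [tensorPart, zero_add, pow_one, pow_zero] at hx ⊢
    obtain ⟨v, rfl⟩ := hx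
    rw [skewDer_ι]
    exact Submodule.algebraMap_mem _
  | succ n ih =>
    rw [tensorPart, pow_succ'] at hx
    induction hx using Submodule.mul_induction_on' with
    | mem_mul_mem a ha b hb =>
      obtain ⟨v, rfl⟩ := ha
      rw [← Y.counit_coaction v, Finsupp.sum, map_sum, Finset.sum_mul, map_sum]
      refine Submodule.sum_mem _ fun g _ => ?_
      rw [skewDer_ι_mul f (Y.coaction_apply_mem v g)]
      refine add_mem ?_ (Submodule.smul_mem _ _ (Y.tensorAction_mem_tensorPart g hb))
      rw [tensorPart, pow_succ']
      exact Submodule.mul_mem_mul ⟨_, rfl⟩ (ih hb)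
    | add a _ b _ ha hb => rw [map_add]; exact add_mem ha hb

theorem skewDer_eq_zero_of_mem (f : Module.Dual k V) {x : TensorAlgebra k V}
    (hx : x ∈ tensorPart k V 0) : Y.skewDer f x = 0 := by
  rw [tensorPart, pow_zero] at hx
  obtain ⟨c, rfl⟩ := Submodule.mem_one.1 hx
  rw [Algebra.algebraMap_eq_smul_one, map_smul, skewDer_one, smul_zero]

theorem decompose_skewDer (f : Module.Dual k V) (x : TensorAlgebra k V) (n : ℕ) :
    (DirectSum.decompose (tensorPart k V) (Y.skewDer f x) n : TensorAlgebra k V) =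
      Y.skewDer f (DirectSum.decompose (tensorPart k V) x (n + 1)) := by
  induction x using DirectSum.Decomposition.inductionOn (tensorPart k V) with
  | zero => simp
  | add x y hx hy => simp [hx, hy]
  | @homogeneous m x =>
    obtain ⟨x, hx⟩ := x
    rcases m with _ | m
    · rw [Y.skewDer_eq_zero_of_mem f hx,
        DirectSum.decompose_of_mem_ne (tensorPart k V) hx (Nat.succ_ne_zero n).symm]
      simp
    · have hd := Y.skewDer_mem_tensorPart f hx
      by_cases h : m = n
      · subst h
        rw [DirectSum.decompose_of_mem_same _ hd, DirectSum.decompose_of_mem_same _ hx]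
      · rw [DirectSum.decompose_of_mem_ne _ hd h,
          DirectSum.decompose_of_mem_ne _ hx (by simpa using h), map_zero]

/-! ### The Nichols ideal in terms of skew derivations -/

/-- The linear form `v ↦ φ v_g` on `V`. -/
noncomputable def homDual (g : G) (φ : Module.Dual k V) : Module.Dual k V :=
  φ ∘ₗ Finsupp.lapply g ∘ₗ Y.coaction

theorem homDual_comp_action (g h : G) (φ : Module.Dual k V) :
    Y.homDual g φ ∘ₗ Y.action h = Y.homDual (h⁻¹ * g * h) (φ ∘ₗ Y.action h) := by
  ext v
  have := Y.compat h v (h⁻¹ * g * h)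
  rw [show h * (h⁻¹ * g * h) * h⁻¹ = g by group] at this
  simp [homDual, this]

/-- A form concentrated in one degree g gives a genuine (id, g)-skew derivation. For general f the
twist would depend on the degree, which is why the radical is defined with forms `homDual`. -/
theorem skewDer_homDual_mul (g : G) (φ : Module.Dual k V) (x y : TensorAlgebra k V) :
    Y.skewDer (Y.homDual g φ) (x * y) = x * Y.skewDer (Y.homDual g φ) y +
      Y.skewDer (Y.homDual g φ) x * Y.tensorAction g y := by
  induction x using Y.induction_left with
  | one => simp
  | add a b ha hb => simp only [add_mul, map_add, ha, hb]; abel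
  | smul c x hx => simp only [map_smul, smul_mul_assoc, hx, smul_add]
  | mul h v hv x hx =>
    have hv' : Y.coaction v = Finsupp.single h v := hv
    rw [mul_assoc, skewDer_ι_mul _ hv, skewDer_ι_mul _ hv, hx]
    by_cases hg : h = g
    · subst hg; simp only [map_mul, mul_add, add_mul, mul_assoc, smul_mul_assoc]; abel
    · have : Y.homDual g φ v = 0 := by
        simp [homDual, hv', Finsupp.single_eq_of_ne (Ne.symm hg)]
      simp [this, mul_add, mul_assoc]

/-- The composition of a sequence of skew derivations with respect to homogeneous linear forms. -/
noncomputable def skewDers :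
    List (G × Module.Dual k V) → (TensorAlgebra k V →ₗ[k] TensorAlgebra k V)
  | [] => LinearMap.id
  | p :: l => skewDers l ∘ₗ Y.skewDer (Y.homDual p.1 p.2)

/-- The linear form `x ↦ ε (∂_{f_r} ⋯ ∂_{f_1} x)` on `T(V)`. -/
noncomputable def skewForm (l : List (G × Module.Dual k V)) : TensorAlgebra k V →ₗ[k] k :=
  TensorAlgebra.algebraMapInv.toLinearMap ∘ₗ Y.skewDers l

/-- The elements of `T(V)` which are annihilated by all compositions of skew derivations followed
by the counit. -/
noncomputable def radical : Submodule k (TensorAlgebra k V) :=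
  ⨅ l, LinearMap.ker (Y.skewForm l)

variable {Y} in
theorem mem_radical {x : TensorAlgebra k V} : x ∈ Y.radical ↔ ∀ l, Y.skewForm l x = 0 := by
  simp [radical]

variable {Y} in
theorem mem_radical_iff {x : TensorAlgebra k V} : x ∈ Y.radical ↔
    TensorAlgebra.algebraMapInv x = 0 ∧ ∀ g φ, Y.skewDer (Y.homDual g φ) x ∈ Y.radical := by
  simp only [mem_radical]
  refine ⟨fun h => ⟨h [], fun g φ l => h ((g, φ) :: l)⟩, fun h l => ?_⟩
  rcases l with _ | ⟨p, l⟩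
  · exact h.1
  · exact h.2 p.1 p.2 l

/-- The radical is the largest subspace of ker ε stable under the homogeneous skew derivations. Each
closure property of the radical below follows by applying this to the enlarged subspace. -/
theorem le_radical (S : Submodule k (TensorAlgebra k V))
    (h₀ : ∀ x ∈ S, TensorAlgebra.algebraMapInv x = 0)
    (h₁ : ∀ x ∈ S, ∀ g φ, Y.skewDer (Y.homDual g φ) x ∈ S) : S ≤ Y.radical := by
  intro x hx
  rw [mem_radical]
  intro l
  induction l generalizing x with
  | nil => exact h₀ x hx
  | cons p l ih => exact ih (h₁ x hx p.1 p.2)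

variable {Y} in
theorem tensorAction_mem_radical {x : TensorAlgebra k V} (hx : x ∈ Y.radical) (g : G) :
    Y.tensorAction g x ∈ Y.radical := by
  refine Y.le_radical (Y.radical.map (Y.tensorAction g).toLinearMap) ?_ ?_ ⟨x, hx, rfl⟩
  · rintro _ ⟨x, hx, rfl⟩
    simpa using (mem_radical_iff.1 hx).1
  · rintro _ ⟨x, hx, rfl⟩ h φ
    refine ⟨_, (mem_radical_iff.1 hx).2 (g⁻¹ * h * g) (φ ∘ₗ Y.action g), ?_⟩
    simp [skewDer_tensorAction, homDual_comp_action]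

variable {Y} in
-- The space T(V)·radical is stable under derivations: the twisted Leibniz rule produces only
-- factors ∂b and g·b on the right, both again in the radical.
theorem mul_mem_radical_left (y : TensorAlgebra k V) {x : TensorAlgebra k V}
    (hx : x ∈ Y.radical) : y * x ∈ Y.radical := by
  refine Y.le_radical (⊤ * Y.radical) ?_ ?_ (Submodule.mul_mem_mul Submodule.mem_top hx)
  · intro z hz
    induction hz using Submodule.mul_induction_on' with
    | mem_mul_mem a _ b hb => rw [map_mul, (mem_radical_iff.1 hb).1, mul_zero]
    | add a _ b _ ha hb => rw [map_add, ha, hb, add_zero]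
  · intro z hz g φ
    induction hz using Submodule.mul_induction_on' with
    | mem_mul_mem a _ b hb =>
      rw [skewDer_homDual_mul]
      exact add_mem (Submodule.mul_mem_mul Submodule.mem_top ((mem_radical_iff.1 hb).2 g φ))
        (Submodule.mul_mem_mul Submodule.mem_top (tensorAction_mem_radical hb g))
    | add a _ b _ ha hb => rw [map_add]; exact add_mem ha hb

variable {Y} in
theorem mul_mem_radical_right {x : TensorAlgebra k V} (hx : x ∈ Y.radical)
    (y : TensorAlgebra k V) : x * y ∈ Y.radical := by
  refine Y.le_radical (Y.radical * ⊤) ?_ ?_ (Submodule.mul_mem_mul hx Submodule.mem_top)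
  · intro z hz
    induction hz using Submodule.mul_induction_on' with
    | mem_mul_mem a ha b _ => rw [map_mul, (mem_radical_iff.1 ha).1, zero_mul]
    | add a _ b _ ha hb => rw [map_add, ha, hb, add_zero]
  · intro z hz g φ
    induction hz using Submodule.mul_induction_on' with
    | mem_mul_mem a ha b _ =>
      rw [skewDer_homDual_mul]
      exact add_mem (Submodule.mul_mem_mul ha Submodule.mem_top)
        (Submodule.mul_mem_mul ((mem_radical_iff.1 ha).2 g φ) Submodule.mem_top)
    | add a _ b _ ha hb => rw [map_add]; exact add_mem ha hb

/-! ### The radical is a homogeneous coideal -/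

theorem algebraMapInv_decompose_zero (x : TensorAlgebra k V) :
    TensorAlgebra.algebraMapInv (DirectSum.decompose (tensorPart k V) x 0 : TensorAlgebra k V) =
      TensorAlgebra.algebraMapInv x := by
  classical
  conv_rhs => rw [← DirectSum.sum_support_decompose (tensorPart k V) x, map_sum]
  rw [Finset.sum_eq_single 0]
  · intro n _ hn
    exact algebraMapInv_eq_zero_of_mem_tensorPart hn (SetLike.coe_mem _)
  · intro h
    rw [DFinsupp.notMem_support_iff.1 h]; simp

variable {Y} in
-- Skew derivations lower the degree by exactly one, so the span of all homogeneous components of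
-- radical elements is again stable under them.
theorem decompose_mem_radical {x : TensorAlgebra k V} (hx : x ∈ Y.radical) (n : ℕ) :
    (DirectSum.decompose (tensorPart k V) x n : TensorAlgebra k V) ∈ Y.radical := by
  refine Y.le_radical (Submodule.span k {y | ∃ x ∈ Y.radical, ∃ n,
    (DirectSum.decompose (tensorPart k V) x n : TensorAlgebra k V) = y}) ?_ ?_
    (Submodule.subset_span ⟨x, hx, n, rfl⟩)
  · intro y hy
    induction hy using Submodule.span_induction with
    | mem y hy =>
      obtain ⟨x, hx, n, rfl⟩ := hy
      by_cases hn : n = 0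
      · subst hn
        rw [algebraMapInv_decompose_zero, (mem_radical_iff.1 hx).1]
      · exact algebraMapInv_eq_zero_of_mem_tensorPart hn (SetLike.coe_mem _)
    | zero => simp
    | add a b _ _ ha hb => rw [map_add, ha, hb, add_zero]
    | smul c a _ ha => rw [map_smul, ha, smul_zero]
  · intro y hy g φ
    induction hy using Submodule.span_induction with
    | mem y hy =>
      obtain ⟨x, hx, n, rfl⟩ := hy
      rcases n with _ | n
      · rw [Y.skewDer_eq_zero_of_mem _ (SetLike.coe_mem _)]
        exact zero_mem _
      · rw [← decompose_skewDer]
        exact Submodule.subset_span ⟨_, (mem_radical_iff.1 hx).2 g φ, n, rfl⟩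
    | zero => simp
    | add a b _ _ ha hb => rw [map_add]; exact add_mem ha hb
    | smul c a _ ha => rw [map_smul]; exact Submodule.smul_mem _ _ ha

theorem skewForm_comul (l : List (G × Module.Dual k V)) (x : TensorAlgebra k V) :
    TensorProduct.rid k _ (LinearMap.lTensor _ (Y.skewForm l) (Y.comul x)) = Y.skewDers l x := by
  induction l generalizing x with
  | nil => exact Y.counit_comul x
  | cons p l ih =>
    rw [show Y.skewForm (p :: l) = Y.skewForm l ∘ₗ Y.skewDer (Y.homDual p.1 p.2) from rfl,
      LinearMap.lTensor_comp, LinearMap.comp_apply, ← comul_skewDer, ih]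
    rfl

variable {Y} in
theorem skewDers_mem_radical {x : TensorAlgebra k V} (hx : x ∈ Y.radical)
    (l : List (G × Module.Dual k V)) : Y.skewDers l x ∈ Y.radical := by
  induction l generalizing x with
  | nil => exact hx
  | cons p l ih => exact ih ((mem_radical_iff.1 hx).2 p.1 p.2)

/-- An element of `M ⊗ N` is zero if it is annihilated by `id ⊗ f` for all `f` in a family of linear
forms that separates the points of `N`. -/
theorem _root_.TensorProduct.eq_zero_of_forall_lTensor {M N ι : Type*} [AddCommGroup M]
    [Module k M] [AddCommGroup N] [Module k N] (f : ι → Module.Dual k N)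
    (hf : ∀ n, (∀ i, f i n = 0) → n = 0) (z : M ⊗[k] N)
    (hz : ∀ i, LinearMap.lTensor M (f i) z = 0) : z = 0 := by
  classical
  let b := Module.Free.chooseBasis k M
  have key : ∀ i (z : M ⊗[k] N), TensorProduct.equivFinsuppOfBasisLeft (N := k) b
      (LinearMap.lTensor M (f i) z) =
      (TensorProduct.equivFinsuppOfBasisLeft b z).mapRange (f i) (map_zero _) := by
    intro i z
    induction z using TensorProduct.induction_on with
    | zero => simp
    | add x y hx hy => rw [map_add, map_add, hx, hy, map_add]; ext; simp
    | tmul m n => ext; simp [TensorProduct.equivFinsuppOfBasisLeft_apply_tmul]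
  rw [← (TensorProduct.equivFinsuppOfBasisLeft (N := N) b).map_eq_zero_iff]
  ext j
  refine hf _ fun i => ?_
  have := key i z
  rw [hz i, map_zero] at this
  simpa using (DFunLike.congr_fun this j).symm

variable {Y} in
-- The right-hand side is the kernel of q ⊗ q, with q the quotient map by the radical. The forms
-- `skewForm l` separate points of the quotient, so it suffices to apply id ⊗ `skewForm l` to Δx;
-- this gives iterated derivatives of x, which lie in the radical.
theorem comul_mem_of_mem_radical {x : TensorAlgebra k V} (hx : x ∈ Y.radical) :
    Y.comul x ∈
      LinearMap.range (TensorProduct.map Y.radical.subtype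
        (LinearMap.id : TensorAlgebra k V →ₗ[k] TensorAlgebra k V)) ⊔
      LinearMap.range (TensorProduct.map
        (LinearMap.id : TensorAlgebra k V →ₗ[k] TensorAlgebra k V) Y.radical.subtype) := by
  have hex : Function.Exact Y.radical.subtype Y.radical.mkQ :=
    LinearMap.exact_subtype_mkQ _
  have hsurj := Y.radical.mkQ_surjective
  have hker := TensorProduct.map_ker (f := Y.radical.subtype) (g := Y.radical.mkQ) hex hsurj
    (f' := Y.radical.subtype) (g' := Y.radical.mkQ) hex hsurj
  rw [sup_comm] at hker
  change _ ∈ LinearMap.range (LinearMap.rTensor _ Y.radical.subtype) ⊔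
    LinearMap.range (LinearMap.lTensor _ Y.radical.subtype)
  rw [← hker, LinearMap.mem_ker]
  have hle : ∀ l, Y.radical ≤ LinearMap.ker (Y.skewForm l) := fun l => iInf_le _ l
  refine TensorProduct.eq_zero_of_forall_lTensor
    (fun l => Y.radical.liftQ (Y.skewForm l) (hle l)) ?_ _ fun l => ?_
  · intro n hn
    obtain ⟨y, rfl⟩ := hsurj n
    rw [Submodule.mkQ_apply, Submodule.Quotient.mk_eq_zero, mem_radical]
    exact hn
  · rw [← LinearMap.comp_apply, LinearMap.lTensor_comp_map, Submodule.liftQ_mkQ,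
      ← LinearMap.rTensor_comp_lTensor, LinearMap.comp_apply]
    have := Y.skewForm_comul l x
    rw [← LinearEquiv.eq_symm_apply] at this
    rw [this, TensorProduct.rid_symm_apply, LinearMap.rTensor_tmul, Submodule.mkQ_apply,
      (Submodule.Quotient.mk_eq_zero _).2 (skewDers_mem_radical hx l), TensorProduct.zero_tmul]

/-- The radical as a left ideal. -/
noncomputable def radicalIdeal : Ideal (TensorAlgebra k V) where
  __ := Y.radical.toAddSubmonoid
  smul_mem' y _ hx := mul_mem_radical_left y hx

theorem isHomogeneousBiideal_radicalIdeal : Y.IsHomogeneousBiideal Y.radicalIdeal where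
  isTwoSided := ⟨fun b ha => mul_mem_radical_right ha b⟩
  isHomogeneous n x hx := decompose_mem_radical hx n
  degree_ge_two x hx n hn := by
    have hx' : (DirectSum.decompose (tensorPart k V) x n : TensorAlgebra k V) ∈ Y.radical :=
      decompose_mem_radical hx n
    have hm : (DirectSum.decompose (tensorPart k V) x n : TensorAlgebra k V) ∈
      tensorPart k V n := SetLike.coe_mem _
    generalize (DirectSum.decompose (tensorPart k V) x n : TensorAlgebra k V) = y at hx' hm
    interval_cases n
    · rw [tensorPart, pow_zero] at hm
      obtain ⟨c, rfl⟩ := Submodule.mem_one.1 hm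
      have := (mem_radical_iff.1 hx').1
      rw [AlgHom.commutes] at this
      rw [show c = 0 from this, map_zero]
    · rw [tensorPart, pow_one] at hm
      obtain ⟨v, rfl⟩ := hm
      -- In degree one, the derivative along `homDual g φ` is the scalar φ(v_g), so all components
      -- of v vanish.
      have : Y.coaction v = 0 := by
        ext g
        rw [Finsupp.zero_apply, ← Module.forall_dual_apply_eq_zero_iff k]
        intro φ
        have := (mem_radical_iff.1 ((mem_radical_iff.1 hx').2 g φ)).1
        rw [skewDer_ι, AlgHom.commutes] at this
        exact this
      rw [← Y.counit_coaction v, this]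
      simp
  isCoideal _ hx := comul_mem_of_mem_radical hx

variable {Y} in
-- Applying id ⊗ f to I ⊗ T(V) + T(V) ⊗ I, the first summand stays in I and the second dies, because
-- f sees only degree one and I starts in degree two.
theorem IsHomogeneousBiideal.skewDer_mem {I : Ideal (TensorAlgebra k V)}
    (hI : Y.IsHomogeneousBiideal I) (f : Module.Dual k V) {x : TensorAlgebra k V} (hx : x ∈ I) :
    Y.skewDer f x ∈ I := by
  have := hI.isTwoSided
  have h1 : ∀ y ∈ I, degreeOne f y = 0 := by
    intro y hy
    classical
    rw [← DirectSum.sum_support_decompose (tensorPart k V) y, map_sum]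
    refine Finset.sum_eq_zero fun n _ => ?_
    rcases n with _ | _ | n
    · rw [hI.degree_ge_two y hy 0 (by omega), map_zero]
    · rw [hI.degree_ge_two y hy 1 (by omega), map_zero]
    · exact degreeOne_eq_zero_of_mem f (n := n) (SetLike.coe_mem _)
  obtain ⟨a, ⟨a, rfl⟩, b, ⟨b, rfl⟩, hab⟩ := Submodule.mem_sup.1 (hI.isCoideal x hx)
  rw [skewDer, LinearMap.comp_apply, LinearMap.comp_apply, ← hab, map_add, map_add]
  clear hab
  refine add_mem ?_ ?_
  · induction a using TensorProduct.induction_on with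
    | zero => simp
    | add a b ha hb => rw [map_add, map_add, map_add]; exact add_mem ha hb
    | tmul a b =>
      simp only [TensorProduct.map_tmul, LinearMap.lTensor_tmul, LinearEquiv.coe_coe,
        TensorProduct.rid_tmul]
      exact (I.restrictScalars k).smul_mem _ a.2
  · induction b using TensorProduct.induction_on with
    | zero => simp
    | add a b ha hb => rw [map_add, map_add, map_add]; exact add_mem ha hb
    | tmul a b =>
      simp only [TensorProduct.map_tmul, LinearMap.lTensor_tmul, LinearEquiv.coe_coe,
        TensorProduct.rid_tmul, Submodule.subtype_apply]
      rw [h1 _ b.2, zero_smul]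
      exact zero_mem _

theorem nicholsIdeal_eq : Y.nicholsIdeal = Y.radicalIdeal := by
  refine le_antisymm (sSup_le fun I hI => ?_) (le_sSup Y.isHomogeneousBiideal_radicalIdeal)
  intro x hx
  refine Y.le_radical (I.restrictScalars k) ?_ (fun y hy g φ => hI.skewDer_mem _ hy) hx
  intro y hy
  exact Y.algebraMapInv_eq_zero_of_mem_nicholsIdeal y
    (Ideal.mem_sSup_of_mem hI hy)

theorem mem_nicholsIdeal {x : TensorAlgebra k V} : x ∈ Y.nicholsIdeal ↔ x ∈ Y.radical := by
  rw [nicholsIdeal_eq]; rfl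

end YetterDrinfeld
/-! ### Algebras with skew derivations of tetrahedral type -/

namespace Tetra

/-- An algebra generated by four elements `v i`, together with algebra maps `g i` with
`g i (v j) = - v (i ◃ j)` and `g i`-skew derivations `D i` with `D i (v j) = δ_{ij}`, such that only
zero is annihilated by all `D i` and the counit. -/
structure SkewAlgebra (k : Type*) (A : Type*) [Field k] [Ring A] [Algebra k A] where
  /-- the generators -/
  v : Tetra → A
  /-- the action -/
  g : Tetra → A →ₐ[k] A
  /-- the skew derivations -/
  D : Tetra → A →ₗ[k] A
  /-- the counit -/
  ε : A →ₐ[k] k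
  adjoin_v : Algebra.adjoin k (Set.range v) = ⊤
  g_v : ∀ i j, g i (v j) = - v (i ◃ j)
  D_one : ∀ i, D i 1 = 0
  D_v_mul : ∀ i j y, D i (v j * y) = v j * D i y + if i = j then g i y else 0
  ε_v : ∀ i, ε (v i) = 0
  eq_zero : ∀ y, ε y = 0 → (∀ i, D i y = 0) → y = 0

theorem act_table :
    ((p1 ◃ p1 = p1 ∧ p1 ◃ p2 = p4) ∧ (p1 ◃ p3 = p2 ∧ p1 ◃ p4 = p3)) ∧
    ((p2 ◃ p1 = p3 ∧ p2 ◃ p2 = p2) ∧ (p2 ◃ p3 = p4 ∧ p2 ◃ p4 = p1)) ∧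
    ((p3 ◃ p1 = p4 ∧ p3 ◃ p2 = p1) ∧ (p3 ◃ p3 = p3 ∧ p3 ◃ p4 = p2)) ∧
    ((p4 ◃ p1 = p2 ∧ p4 ◃ p2 = p3) ∧ (p4 ◃ p3 = p1 ∧ p4 ◃ p4 = p4)) := by
  decide

namespace SkewAlgebra

variable {k A : Type*} [Field k] [Ring A] [Algebra k A] (S : SkewAlgebra k A)

theorem induction_left {P : A → Prop} (one : P 1) (add : ∀ x y, P x → P y → P (x + y))
    (smul : ∀ (c : k) x, P x → P (c • x)) (mul : ∀ i x, P x → P (S.v i * x)) (x : A) : P x := by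
  have key : ∀ x ∈ Algebra.adjoin k (Set.range S.v), ∀ y, P y → P (x * y) := by
    intro x hx
    induction hx using Algebra.adjoin_induction with
    | mem x hx => obtain ⟨i, rfl⟩ := hx; exact mul i
    | algebraMap c => intro y hy; rw [← Algebra.smul_def]; exact smul c y hy
    | add a b _ _ ha hb => intro y hy; rw [add_mul]; exact add _ _ (ha y hy) (hb y hy)
    | mul a b _ _ ha hb => intro y hy; rw [mul_assoc]; exact ha _ (hb y hy)
  simpa using key x (by rw [S.adjoin_v]; trivial) 1 one

theorem D_v (i j : Tetra) : S.D i (S.v j) = if i = j then 1 else 0 := by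
  have := S.D_v_mul i j 1
  rwa [mul_one, S.D_one, mul_zero, zero_add, map_one] at this

theorem g_D (i j : Tetra) (x : A) : S.g i (S.D j x) = - S.D (i ◃ j) (S.g i x) := by
  induction x using S.induction_left with
  | one => simp [S.D_one]
  | add a b ha hb => simp only [map_add, ha, hb]; abel
  | smul c x hx => simp only [map_smul, hx, smul_neg]
  | mul l x hx =>
    have hgg : S.g i (S.g j x) = S.g (i ◃ j) (S.g i x) := by
      have : (S.g i).comp (S.g j) = (S.g (i ◃ j)).comp (S.g i) := by
        refine AlgHom.ext_of_adjoin_eq_top S.adjoin_v ?_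
        rintro _ ⟨m, rfl⟩
        simp only [AlgHom.comp_apply, S.g_v, map_neg]
        rw [Shelf.self_distrib]
      exact DFunLike.congr_fun this x
    rw [S.D_v_mul, map_add, map_mul, map_mul, S.g_v, neg_mul, neg_mul, map_neg (S.D _),
      S.D_v_mul, hx]
    have : i ◃ j = i ◃ l ↔ j = l := Rack.left_cancel i
    by_cases h : j = l
    · subst h; simp [hgg]
    · simp [h, this]

/-! #### Relations -/

theorem v_mul_self (i : Tetra) : S.v i * S.v i = 0 := by
  refine S.eq_zero _ (by simp [S.ε_v]) fun j => ?_
  rw [S.D_v_mul, S.D_v]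
  split_ifs with h
  · subst h; rw [S.g_v, show j ◃ j = j by cases j <;> simp [act_table]]; simp
  · simp

theorem v_mul_v_add {i j : Tetra} (h : i ≠ j) :
    S.v i * S.v j + S.v (i ◃ j) * S.v i + S.v j * S.v (i ◃ j) = 0 := by
  refine S.eq_zero _ (by simp [S.ε_v]) fun l => ?_
  cases i <;> cases j <;> first | exact absurd rfl h | skip
  all_goals cases l <;> simp [S.D_v_mul, S.D_v, S.g_v, act_table]

theorem D_D_add {i j : Tetra} (h : i ≠ j) (x : A) :
    S.D i (S.D j x) + S.D (i ◃ j) (S.D i x) + S.D j (S.D (i ◃ j) x) = 0 := by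
  induction x using S.induction_left with
  | one => simp [S.D_one]
  | add a b ha hb =>
    rw [← add_zero (0 : A)]
    nth_rw 1 [← ha]
    rw [← hb]; simp only [map_add]; abel
  | smul c x hx => simp only [map_smul, ← smul_add, hx, smul_zero]
  | mul l x hx =>
    -- Subtracting v_l times the induction hypothesis leaves only the terms in which a derivation
    -- has hit v_l; these cancel by `g_D`.
    have h0 := congrArg (S.v l * ·) hx
    simp only [mul_add, mul_zero] at h0
    rw [← h0]
    cases i <;> cases j <;> first | exact absurd rfl h | skip
    all_goals cases l <;> simp [S.D_v_mul, S.g_D, act_table] <;> abel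

/-- The four cyclic quadratic relations, oriented as rewriting rules that move v₃ to the right and
v₁ to the left of v₄. -/
theorem word_rules :
    (S.v p4 * S.v p1 = - (S.v p1 * S.v p2) - S.v p2 * S.v p4) ∧
    (S.v p3 * S.v p1 = - (S.v p1 * S.v p4) - S.v p4 * S.v p3) ∧
    (S.v p3 * S.v p2 = - (S.v p1 * S.v p3) - S.v p2 * S.v p1) ∧
    (S.v p3 * S.v p4 = - (S.v p2 * S.v p3) - S.v p4 * S.v p2) := by
  have h1 := S.v_mul_v_add (i := p1) (j := p2) (by decide)
  have h2 := S.v_mul_v_add (i := p1) (j := p4) (by decide)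
  have h3 := S.v_mul_v_add (i := p1) (j := p3) (by decide)
  have h4 := S.v_mul_v_add (i := p2) (j := p3) (by decide)
  simp only [act_table] at h1 h2 h3 h4
  refine ⟨?_, ?_, ?_, ?_⟩
  · rw [← sub_eq_zero, ← h1]; abel
  · rw [← sub_eq_zero, ← h2]; abel
  · rw [← sub_eq_zero, ← h3]; abel
  · rw [← sub_eq_zero, ← h4]; abel

theorem v_mul_self_mul (i : Tetra) (x : A) : S.v i * (S.v i * x) = 0 := by
  rw [← mul_assoc, v_mul_self, zero_mul]

theorem v4_mul_v1_mul (x : A) :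
    S.v p4 * (S.v p1 * x) = - (S.v p1 * (S.v p2 * x)) - S.v p2 * (S.v p4 * x) := by
  rw [← mul_assoc, S.word_rules.1]; noncomm_ring

theorem v3_mul_v1_mul (x : A) :
    S.v p3 * (S.v p1 * x) = - (S.v p1 * (S.v p4 * x)) - S.v p4 * (S.v p3 * x) := by
  rw [← mul_assoc, S.word_rules.2.1]; noncomm_ring

theorem v3_mul_v2_mul (x : A) :
    S.v p3 * (S.v p2 * x) = - (S.v p1 * (S.v p3 * x)) - S.v p2 * (S.v p1 * x) := by
  rw [← mul_assoc, S.word_rules.2.2.1]; noncomm_ring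

theorem v3_mul_v4_mul (x : A) :
    S.v p3 * (S.v p4 * x) = - (S.v p2 * (S.v p3 * x)) - S.v p4 * (S.v p2 * x) := by
  rw [← mul_assoc, S.word_rules.2.2.2]; noncomm_ring

/-- The braid relation follows from v₄v₁² = 0 on rewriting v₄v₁ twice. -/
theorem v2_v1_v2_mul (x : A) :
    S.v p2 * (S.v p1 * (S.v p2 * x)) = S.v p1 * (S.v p2 * (S.v p1 * x)) := by
  have h : S.v p4 * (S.v p1 * (S.v p1 * x)) = 0 := by rw [v_mul_self_mul, mul_zero]
  have h' : S.v p2 * (S.v p4 * (S.v p1 * x)) + S.v p1 * (S.v p2 * (S.v p1 * x)) = 0 := by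
    rw [v4_mul_v1_mul] at h
    rw [← neg_eq_zero, ← h]; abel
  rw [v4_mul_v1_mul, mul_sub, mul_neg, v_mul_self_mul] at h'
  rw [← sub_eq_zero, ← neg_eq_zero, ← h']; abel

theorem v4_v2_v4_mul (x : A) :
    S.v p4 * (S.v p2 * (S.v p4 * x)) = S.v p2 * (S.v p4 * (S.v p2 * x)) := by
  have h : S.v p4 * (S.v p4 * (S.v p1 * x)) = 0 := S.v_mul_self_mul _ _
  rw [v4_mul_v1_mul, mul_sub, mul_neg, v4_mul_v1_mul, v_mul_self_mul, mul_zero] at h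
  rw [← sub_eq_zero, ← neg_eq_zero, ← h]; abel

/-- The sum of the cyclic rotations of (v₄v₂v₁)² vanishes: each derivative has degree five and
cancels after rewriting with the quadratic and braid rules. -/
theorem sextic_relation : S.v p4 * (S.v p2 * (S.v p1 * (S.v p4 * (S.v p2 * S.v p1)))) =
    - (S.v p2 * (S.v p1 * (S.v p4 * (S.v p2 * (S.v p1 * S.v p4))))) -
      S.v p1 * (S.v p4 * (S.v p2 * (S.v p1 * (S.v p4 * S.v p2)))) := by
  rw [← sub_eq_zero]
  refine S.eq_zero _ (by simp [S.ε_v]) fun l => ?_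
  cases l <;> simp [S.D_v_mul, S.D_v, S.g_v, act_table] <;>
    simp only [S.v_mul_self, S.v_mul_self_mul, S.word_rules, S.v4_mul_v1_mul, S.v3_mul_v1_mul,
      S.v3_mul_v2_mul, S.v3_mul_v4_mul, S.v2_v1_v2_mul, S.v4_v2_v4_mul, mul_sub, mul_neg, mul_zero,
      neg_zero, sub_zero, zero_sub, neg_neg, mul_add] <;>
    abel

/-- Here the derivatives cancel only up to multiples of 2; the relation is the analogue of
`sextic_relation` for v₄v₂v₁ itself. -/
theorem cubic_relation [CharP k 2] : S.v p4 * (S.v p2 * S.v p1) =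
    S.v p1 * (S.v p4 * S.v p2) + S.v p2 * (S.v p1 * S.v p4) := by
  have h2 : ∀ x : A, x + x = 0 := fun x => by
    rw [← two_smul k x, show (2 : k) = 0 from CharP.cast_eq_zero k 2, zero_smul]
  have hn : ∀ x : A, -x = x := fun x => neg_eq_of_add_eq_zero_left (h2 x)
  rw [← sub_eq_zero]
  refine S.eq_zero _ (by simp [S.ε_v]) fun l => ?_
  cases l <;> simp [S.D_v_mul, S.D_v, S.g_v, act_table] <;>
    simp only [S.word_rules, hn, sub_eq_add_neg] <;>
    abel_nf <;> simp [two_smul, h2]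

end SkewAlgebra
end Tetra
namespace Tetra

/-! #### Basis words -/

/-- The words `p1^i (p2 p1)_j`, where the second factor is the prefix of length `j`. -/
def wordF (p : Fin 2 × Fin 3) : List Tetra :=
  List.take p.1 [p1] ++ List.take p.2 [p2, p1]

/-- The prefixes of `p4 p2 p1 p4 p2`. -/
def wordP (l : ℕ) : List Tetra := List.take l [p4, p2, p1, p4, p2]

/-- The words which index the monomial basis, with `n ≤ 6` choices for the third factor. -/
def basisWord (n : ℕ) (p : ((Fin 2 × Fin 3) × Fin n) × Fin 2) : List Tetra :=
  wordF p.1.1 ++ wordP p.1.2 ++ List.take p.2 [p3]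

theorem wordF_mem (p : Fin 2 × Fin 3) : ∀ i ∈ wordF p, i = p1 ∨ i = p2 := by
  revert p; decide

theorem p3_notMem (p : Fin 2 × Fin 3) (l : ℕ) : p3 ∉ wordF p ++ wordP l := by
  rw [List.mem_append, not_or]
  exact ⟨fun h => by simpa using wordF_mem p _ h, fun h => by simpa using List.mem_of_mem_take h⟩

namespace SkewAlgebra

variable {k A : Type*} [Field k] [Ring A] [Algebra k A] (S : SkewAlgebra k A)

/-! #### Words -/

/-- The product of the generators along a list. -/
def word (l : List Tetra) : A := (l.map S.v).prod

@[simp] theorem word_nil : S.word [] = 1 := rfl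

@[simp] theorem word_cons (i : Tetra) (l : List Tetra) : S.word (i :: l) = S.v i * S.word l := by
  simp [word]

theorem word_append (l m : List Tetra) : S.word (l ++ m) = S.word l * S.word m := by
  simp [word]

theorem D_word_mul {i : Tetra} {l : List Tetra} (h : i ∉ l) (x : A) :
    S.D i (S.word l * x) = S.word l * S.D i x := by
  induction l with
  | nil => simp
  | cons j l ih =>
    rw [List.mem_cons, not_or] at h
    rw [word_cons, mul_assoc, D_v_mul, ih h.2, if_neg h.1, add_zero, mul_assoc]

theorem D_word {i : Tetra} {l : List Tetra} (h : i ∉ l) : S.D i (S.word l) = 0 := by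
  simpa [S.D_one] using S.D_word_mul h 1

/-! #### Linear independence -/

/-- A third order skew differential operator that commutes with the left multiplications by
`v p1` and `v p2`. -/
def cubicD : A →ₗ[k] A :=
  S.D p4 ∘ₗ S.D p3 ∘ₗ S.D p2 + S.D p2 ∘ₗ S.D p4 ∘ₗ S.D p3 - S.D p3 ∘ₗ S.D p2 ∘ₗ S.D p4

theorem cubicD_v1_mul (x : A) : S.cubicD (S.v p1 * x) = S.v p1 * S.cubicD x := by
  simp [cubicD, S.D_v_mul, mul_add, mul_sub]

theorem cubicD_v2_mul (x : A) : S.cubicD (S.v p2 * x) = S.v p2 * S.cubicD x := by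
  -- Moving g₂ to the right of the derivations turns the three extra terms into (D₄D₃ + D₁D₄ + D₃D₁)
  -- g₂ x, one of the quadratic relations between derivations.
  have h := S.D_D_add (i := p4) (j := p3) (by decide) (S.g p2 x)
  simp only [act_table] at h
  simp only [cubicD, LinearMap.add_apply, LinearMap.sub_apply, LinearMap.comp_apply, S.D_v_mul,
    reduceCtorEq, if_false, if_true, add_zero, map_add, S.g_D, act_table, map_neg, neg_neg,
    mul_add, mul_sub]
  rw [← sub_eq_zero, ← h]; abel

theorem cubicD_word_mul {l : List Tetra} (h : ∀ i ∈ l, i = p1 ∨ i = p2) (x : A) :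
    S.cubicD (S.word l * x) = S.word l * S.cubicD x := by
  induction l with
  | nil => simp
  | cons j l ih =>
    have := ih fun i hi => h i (List.mem_cons_of_mem _ hi)
    rcases h j List.mem_cons_self with rfl | rfl
    · rw [word_cons, mul_assoc, cubicD_v1_mul, this, mul_assoc]
    · rw [word_cons, mul_assoc, cubicD_v2_mul, this, mul_assoc]

theorem linearIndependent_wordF : LinearIndependent k fun p => S.word (wordF p) := by
  rw [Fintype.linearIndependent_iff]
  intro c hc
  simp only [Fintype.sum_prod_type, Fin.sum_univ_two, Fin.sum_univ_three] at hc
  simp [wordF, add_assoc] at hc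
  have h0 := congrArg S.ε hc
  have h1 := congrArg (fun x => S.ε (S.D p1 x)) hc
  have h2 := congrArg (fun x => S.ε (S.D p2 x)) hc
  -- D₁ turns v₁v₂ into g₁v₂ = -v₄, so the second operator detecting this word is D₄ rather than D₂.
  have h12 := congrArg (fun x => S.ε (S.D p4 (S.D p1 x))) hc
  have h21 := congrArg (fun x => S.ε (S.D p2 (S.D p1 x))) hc
  have h121 := congrArg (fun x => S.ε (S.D p1 (S.D p2 (S.D p1 x)))) hc
  simp [S.ε_v, S.D_v_mul, S.D_v, S.D_one, S.g_v, act_table] at h0 h1 h2 h12 h21 h121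
  rintro ⟨i, j⟩
  fin_cases i <;> fin_cases j <;> assumption

/-- A criterion for the linear independence of products. -/
theorem linearIndependent_mul {ι : Type*} [Fintype ι] {n : ℕ} {f : ι → A} {P : Fin n → A}
    (hf : LinearIndependent k f) (E : Fin n → A →ₗ[k] A) (u : Fin n → k) (hu : ∀ j, u j ≠ 0)
    (h₀ : ∀ i j, i < j → ∀ s, E j (f s * P i) = 0) (h₁ : ∀ j s, E j (f s * P j) = u j • f s) :
    LinearIndependent k fun p : ι × Fin n => f p.1 * P p.2 := by
  rw [Fintype.linearIndependent_iff] at hf ⊢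
  intro c hc
  suffices h : ∀ j s, c (s, j) = 0 from fun p => h p.2 p.1
  intro j
  -- The system is triangular, solved from the largest index down: E_j kills the terms with i < j,
  -- and the coefficients with i > j are already zero.
  induction j using WellFoundedGT.induction with
  | ind j ih =>
    have := congrArg (E j) hc
    rw [Fintype.sum_prod_type, map_sum, map_zero] at this
    refine fun s => (mul_eq_zero.1 (hf (fun s => c (s, j) * u j) ?_ s)).resolve_right (hu j)
    rw [← this]
    refine Finset.sum_congr rfl fun s _ => ?_
    rw [map_sum, Finset.sum_eq_single j]
    · rw [map_smul, h₁, smul_smul]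
    · intro i _ hij
      rcases lt_or_gt_of_ne hij with h | h
      · rw [map_smul, h₀ i j h, smul_zero]
      · rw [ih i h s, zero_smul, map_zero]
    · simp

/-- The operators which detect the factors `wordP l`. -/
def opP : Fin 6 → (A →ₗ[k] A) :=
  ![LinearMap.id, S.D p4, S.D p3 ∘ₗ S.D p4, S.cubicD, S.cubicD ∘ₗ S.D p4,
    S.cubicD ∘ₗ S.D p3 ∘ₗ S.D p4]

theorem opP_mul (j : Fin 6) (p : Fin 2 × Fin 3) (x : A) :
    S.opP j (S.word (wordF p) * x) = S.word (wordF p) * S.opP j x := by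
  have h3 : p3 ∉ wordF p := fun h => by simpa using wordF_mem p _ h
  have h4 : p4 ∉ wordF p := fun h => by simpa using wordF_mem p _ h
  have hc := fun x => S.cubicD_word_mul (wordF_mem p) x
  fin_cases j <;> simp [opP, S.D_word_mul h3, S.D_word_mul h4, hc]

theorem opP_eq_zero (i j : Fin 6) (h : i < j) : S.opP j (S.word (wordP i)) = 0 := by
  fin_cases j <;> fin_cases i <;> first | exact absurd h (by decide) | skip
  all_goals simp [opP, wordP, cubicD, S.D_v_mul, S.D_v, S.D_one, S.g_v, act_table]

/-- The factor 2 occurs exactly from j = 3 on. So three prefixes are detected over every field, and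
all six when 2 is invertible. -/
theorem opP_self (j : Fin 6) : S.opP j (S.word (wordP j)) =
    (![1, 1, -1, -2, -2, 2] j : k) • (1 : A) := by
  fin_cases j
  all_goals
    simp [opP, wordP, cubicD, S.D_v_mul, S.D_v, S.g_v, act_table]
  all_goals (try rw [two_smul]); (try norm_num)

theorem linearIndependent_basisWord {n : ℕ} (hn : n ≤ 6) (h2 : n ≤ 3 ∨ (2 : k) ≠ 0) :
    LinearIndependent k fun p => S.word (basisWord n p) := by
  have h := linearIndependent_mul (P := fun l : Fin n => S.word (wordP l))
    S.linearIndependent_wordF (fun j => S.opP (Fin.castLE hn j))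
    (fun j => (![1, 1, -1, -2, -2, 2] (Fin.castLE hn j) : k)) ?_ ?_ ?_
  · have h' := linearIndependent_mul (P := fun l : Fin 2 => S.word (List.take l [p3]))
      h ![LinearMap.id, S.D p3] (fun _ => 1) (fun _ => one_ne_zero) ?_ ?_
    · simpa only [basisWord, word_append] using h'
    · intro i j hij p
      have hp := p3_notMem p.1 p.2
      rw [← word_append]
      fin_cases j <;> fin_cases i <;> first | exact absurd hij (by decide) | skip
      simp [S.D_word hp]
    · intro j p
      have hp := p3_notMem p.1 p.2
      rw [← word_append]
      fin_cases j
      · simp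
      · simp [S.D_word_mul hp, S.D_v]
  · intro j
    rcases j with ⟨j, hj⟩
    rcases h2 with h2 | h2
    · have : j < 3 := by omega
      interval_cases j <;> simp
    · have : j < 6 := by omega
      interval_cases j <;> simp [h2]
  · intro i j hij s
    rw [opP_mul, show ((i : ℕ)) = (Fin.castLE hn i : Fin 6) from rfl, opP_eq_zero, mul_zero]
    exact hij
  · intro j s
    rw [opP_mul, show ((j : ℕ)) = (Fin.castLE hn j : Fin 6) from rfl, opP_self]
    simp

/-! #### Spanning -/

/-- The span of the basis words without the letter `p3`. -/
def spanFP (n : ℕ) : Submodule k A :=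
  Submodule.span k (Set.range fun p : (Fin 2 × Fin 3) × Fin n => S.word (wordF p.1 ++ wordP p.2))

theorem word_mem_spanFP {n l : ℕ} (p : Fin 2 × Fin 3) (hl : l < n) :
    S.word (wordF p) * S.word (wordP l) ∈ S.spanFP n := by
  rw [← word_append]
  exact Submodule.subset_span ⟨(p, ⟨l, hl⟩), rfl⟩

theorem wordP_mem_spanFP {n l : ℕ} (hl : l < n) : S.word (wordP l) ∈ S.spanFP n := by
  simpa [wordF] using S.word_mem_spanFP (0, 0) hl

theorem mul_mem_spanFP_of {n : ℕ} {x : A}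
    (h : ∀ (p : Fin 2 × Fin 3) (l : ℕ), l < n →
      x * (S.word (wordF p) * S.word (wordP l)) ∈ S.spanFP n)
    {y : A} (hy : y ∈ S.spanFP n) : x * y ∈ S.spanFP n := by
  induction hy using Submodule.span_induction with
  | mem y hy =>
    obtain ⟨⟨p, l⟩, rfl⟩ := hy
    simp only [word_append]
    exact h p l l.2
  | zero => simp
  | add a b _ _ ha hb => rw [mul_add]; exact add_mem ha hb
  | smul c a _ ha => rw [mul_smul_comm]; exact Submodule.smul_mem _ _ ha

theorem v1_mul_mem_spanFP {n : ℕ} {y : A} (hy : y ∈ S.spanFP n) : S.v p1 * y ∈ S.spanFP n := by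
  refine S.mul_mem_spanFP_of (fun p l hl => ?_) hy
  rw [← mul_assoc]
  obtain ⟨i, j⟩ := p
  fin_cases i
  · have := S.word_mem_spanFP (1, j) hl
    simpa [wordF] using this
  · simp [wordF, v_mul_self_mul]

theorem v2_mul_mem_spanFP {n : ℕ} {y : A} (hy : y ∈ S.spanFP n) : S.v p2 * y ∈ S.spanFP n := by
  refine S.mul_mem_spanFP_of (fun p l hl => ?_) hy
  have h1 := S.word_mem_spanFP (0, 1) hl
  have h2 := S.word_mem_spanFP (0, 2) hl
  have h12 := S.word_mem_spanFP (1, 2) hl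
  simp only [wordF, List.nil_append, List.take, word_cons, word_nil, mul_one, List.cons_append,
    mul_assoc] at h1 h2 h12
  obtain ⟨i, j⟩ := p
  fin_cases i <;> fin_cases j
  all_goals simp [wordF, mul_assoc, v_mul_self_mul, v2_v1_v2_mul]
  all_goals assumption

/-- Of the six words in v₁, v₂, those starting with v₁ reduce to the others by rewriting v₄v₁. For 1
and v₂ the relation v₄v₂v₄ = v₂v₄v₂ suffices; only v₂v₁ needs the higher relations, and this case is
the hypothesis H. -/
theorem v4_mul_mem_spanFP {n : ℕ} (hn : 3 ≤ n)
    (H : ∀ l < n, S.v p4 * (S.v p2 * (S.v p1 * S.word (wordP l))) ∈ S.spanFP n)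
    {y : A} (hy : y ∈ S.spanFP n) : S.v p4 * y ∈ S.spanFP n := by
  have h0 : ∀ l < n, S.v p4 * S.word (wordP l) ∈ S.spanFP n := by
    intro l hl
    rcases l with _ | l
    · simpa [wordP] using S.wordP_mem_spanFP (l := 1) (by omega)
    · simp [wordP, v_mul_self_mul]
  have h2 : ∀ l < n, S.v p4 * (S.v p2 * S.word (wordP l)) ∈ S.spanFP n := by
    intro l hl
    rcases l with _ | _ | l
    · simpa [wordP] using S.wordP_mem_spanFP (l := 2) (by omega)
    · have := S.v2_mul_mem_spanFP (S.wordP_mem_spanFP (l := 2) (by omega : 2 < n))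
      have e := S.v4_v2_v4_mul 1
      simp only [mul_one] at e
      simpa [wordP, e] using this
    · simp [wordP, v4_v2_v4_mul, v_mul_self_mul]
  have h1 : ∀ y, S.v p1 * (S.v p2 * y) ∈ S.spanFP n → S.v p4 * y ∈ S.spanFP n →
      S.v p4 * (S.v p1 * y) ∈ S.spanFP n := by
    intro y hy hy'
    rw [v4_mul_v1_mul]
    exact sub_mem (neg_mem hy) (S.v2_mul_mem_spanFP hy')
  refine S.mul_mem_spanFP_of (fun p l hl => ?_) hy
  obtain ⟨i, j⟩ := p
  fin_cases i <;> fin_cases j <;> simp [wordF, mul_assoc]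
  · exact h0 l hl
  · exact h2 l hl
  · exact H l hl
  · exact h1 _ (S.v1_mul_mem_spanFP (S.v2_mul_mem_spanFP (S.wordP_mem_spanFP hl))) (h0 l hl)
  · exact h1 _ (by simp [v_mul_self_mul]) (h2 l hl)
  · exact h1 _ (by simp [v_mul_self_mul]) (H l hl)

/-- Right multiplication of `sextic_relation` by v₄ kills one term, and the braid rules rewrite the
other. -/
theorem septic_relation :
    S.v p4 * (S.v p2 * (S.v p1 * (S.v p4 * (S.v p2 * (S.v p1 * S.v p4))))) =
      S.v p1 * (S.v p2 * (S.v p4 * (S.v p2 * (S.v p1 * (S.v p4 * S.v p2))))) := by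
  have e := S.v4_v2_v4_mul 1
  have h := congrArg (· * S.v p4) S.sextic_relation
  simp only [mul_one] at e
  simpa [sub_mul, mul_assoc, e, v_mul_self, v2_v1_v2_mul, v4_mul_v1_mul, v_mul_self_mul] using h

theorem v4_v2_v1_wordP_mem (l : ℕ) (hl : l < 6) :
    S.v p4 * (S.v p2 * (S.v p1 * S.word (wordP l))) ∈ S.spanFP 6 := by
  have hP := fun l (hl : l < 6) => S.wordP_mem_spanFP hl
  have hr : S.v p4 * (S.v p2 * (S.v p1 * (S.v p4 * (S.v p2 * S.v p1)))) ∈ S.spanFP 6 := by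
    rw [sextic_relation]
    have h4 := S.v2_mul_mem_spanFP (S.v1_mul_mem_spanFP (hP 4 (by omega)))
    have h5 := S.v1_mul_mem_spanFP (hP 5 (by omega))
    simp [wordP] at h4 h5
    exact sub_mem (neg_mem h4) h5
  interval_cases l
  · simpa [wordP] using hP 3 (by omega)
  · simpa [wordP] using hP 4 (by omega)
  · simpa [wordP] using hP 5 (by omega)
  · simpa [wordP] using hr
  · have h5 := S.v1_mul_mem_spanFP (S.v2_mul_mem_spanFP (hP 5 (by omega)))
    simp [wordP] at h5 ⊢
    rwa [septic_relation]
  -- The right-hand side of the degree 7 relation ends in v₂, so multiplying once more by v₂ gives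
  -- zero.
  · have h := congrArg (· * S.v p2) S.septic_relation
    simp only [mul_assoc, v_mul_self, mul_zero] at h
    simp [wordP, h]

theorem v4_v2_v1_wordP_mem_of_charP [CharP k 2] (l : ℕ) (hl : l < 3) :
    S.v p4 * (S.v p2 * (S.v p1 * S.word (wordP l))) ∈ S.spanFP 3 := by
  have hP := fun l (hl : l < 3) => S.wordP_mem_spanFP hl
  have h1 := S.v2_mul_mem_spanFP (S.v1_mul_mem_spanFP (hP 1 (by omega)))
  have h2 := S.v1_mul_mem_spanFP (hP 2 (by omega))
  have h3 := S.v1_mul_mem_spanFP (S.v2_mul_mem_spanFP (hP 2 (by omega)))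
  have e := S.v4_v2_v4_mul 1
  have e1 := congrArg (· * S.v p4) S.cubic_relation
  simp only [mul_one, add_mul, mul_assoc, v_mul_self, mul_zero, add_zero] at e e1
  rw [e] at e1
  have e2 := congrArg (· * S.v p2) e1
  simp only [mul_assoc, v_mul_self, mul_zero] at e2
  simp [wordP] at h1 h2 h3
  interval_cases l
  · simpa [wordP, S.cubic_relation] using add_mem h2 h1
  · simpa [wordP, e1] using h3
  · simp [wordP, e2]

/-- The span of all basis words is the whole algebra. -/
theorem span_basisWord {n : ℕ} (hn : 3 ≤ n)
    (H : ∀ l < n, S.v p4 * (S.v p2 * (S.v p1 * S.word (wordP l))) ∈ S.spanFP n) :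
    Submodule.span k (Set.range fun p => S.word (basisWord n p)) = ⊤ := by
  let R := Algebra.adjoin k {S.v p1, S.v p2, S.v p4}
  have m1 : S.v p1 ∈ R := Algebra.subset_adjoin (by simp)
  have m2 : S.v p2 ∈ R := Algebra.subset_adjoin (by simp)
  have m4 : S.v p4 ∈ R := Algebra.subset_adjoin (by simp)
  have hRM : ∀ r ∈ R, ∀ m ∈ S.spanFP n, r * m ∈ S.spanFP n := by
    intro r hr
    induction hr using Algebra.adjoin_induction with
    | mem x hx =>
      intro m hm
      rcases hx with rfl | rfl | rfl
      · exact S.v1_mul_mem_spanFP hm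
      · exact S.v2_mul_mem_spanFP hm
      · exact S.v4_mul_mem_spanFP hn H hm
    | algebraMap c => intro m hm; rw [← Algebra.smul_def]; exact Submodule.smul_mem _ _ hm
    | add a b _ _ ha hb => intro m hm; rw [add_mul]; exact add_mem (ha m hm) (hb m hm)
    | mul a b _ _ ha hb => intro m hm; rw [mul_assoc]; exact ha _ (hb m hm)
  have hR : ∀ r ∈ R, r ∈ S.spanFP n := fun r hr => by
    simpa [wordP] using hRM r hr _ (S.wordP_mem_spanFP (l := 0) (by omega))
  -- The commutation v₃R ⊆ R + R v₃ holds on generators by three of the quadratic rules and passes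
  -- to products.
  have hd : ∀ r ∈ R, ∃ s ∈ R, ∃ t ∈ R, S.v p3 * r = s + t * S.v p3 := by
    intro r hr
    induction hr using Algebra.adjoin_induction with
    | mem x hx =>
      rcases hx with rfl | rfl | rfl
      · exact ⟨_, neg_mem (mul_mem m1 m4), _, neg_mem m4, by rw [S.word_rules.2.1]; noncomm_ring⟩
      · exact ⟨_, neg_mem (mul_mem m2 m1), _, neg_mem m1, by
          rw [S.word_rules.2.2.1]; noncomm_ring⟩
      · exact ⟨_, neg_mem (mul_mem m4 m2), _, neg_mem m2, by
          rw [S.word_rules.2.2.2]; noncomm_ring⟩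
    | algebraMap c =>
      exact ⟨0, zero_mem _, algebraMap k A c, R.algebraMap_mem c, by
        rw [zero_add, Algebra.commutes]⟩
    | add a b _ _ ha hb =>
      obtain ⟨s, hs, t, ht, e⟩ := ha
      obtain ⟨s', hs', t', ht', e'⟩ := hb
      exact ⟨_, add_mem hs hs', _, add_mem ht ht', by rw [mul_add, e, e']; noncomm_ring⟩
    | mul a b ha' hb' ha hb =>
      obtain ⟨s, hs, t, ht, e⟩ := ha
      obtain ⟨s', hs', t', ht', e'⟩ := hb
      refine ⟨s * b + t * s', add_mem (mul_mem hs hb') (mul_mem ht hs'), t * t',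
        mul_mem ht ht', ?_⟩
      rw [← mul_assoc, e, add_mul, mul_assoc t, e']; noncomm_ring
  -- Since v₃² = 0, the sum R + R v₃ is stable under left multiplication by all four generators,
  -- hence is everything.
  have hA : ∀ y : A, ∃ s ∈ R, ∃ t ∈ R, y = s + t * S.v p3 := by
    intro y
    induction y using S.induction_left with
    | one => exact ⟨1, one_mem _, 0, zero_mem _, by simp⟩
    | add a b ha hb =>
      obtain ⟨s, hs, t, ht, rfl⟩ := ha
      obtain ⟨s', hs', t', ht', rfl⟩ := hb
      exact ⟨_, add_mem hs hs', _, add_mem ht ht', by noncomm_ring⟩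
    | smul c a ha =>
      obtain ⟨s, hs, t, ht, rfl⟩ := ha
      exact ⟨_, R.smul_mem hs c, _, R.smul_mem ht c, by simp⟩
    | mul i a ha =>
      obtain ⟨s, hs, t, ht, rfl⟩ := ha
      have key : ∀ x ∈ R, ∃ s' ∈ R, ∃ t' ∈ R, x * (s + t * S.v p3) = s' + t' * S.v p3 :=
        fun x hx => ⟨_, mul_mem hx hs, _, mul_mem hx ht, by rw [mul_add, mul_assoc]⟩
      cases i
      · exact key _ m1
      · exact key _ m2
      · obtain ⟨s₁, hs₁, t₁, ht₁, e₁⟩ := hd s hs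
        obtain ⟨s₂, hs₂, t₂, ht₂, e₂⟩ := hd t ht
        refine ⟨s₁, hs₁, t₁ + s₂, add_mem ht₁ hs₂, ?_⟩
        rw [mul_add, e₁, ← mul_assoc, e₂, add_mul s₂, mul_assoc t₂, v_mul_self]; noncomm_ring
      · exact key _ m4
  have hM : ∀ m ∈ S.spanFP n, ∀ i : Fin 2, m * S.word (List.take i [p3]) ∈
      Submodule.span k (Set.range fun p => S.word (basisWord n p)) := by
    intro m hm i
    induction hm using Submodule.span_induction with
    | mem y hy =>
      obtain ⟨p, rfl⟩ := hy
      simp only [← word_append]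
      exact Submodule.subset_span ⟨(p, i), rfl⟩
    | zero => simp
    | add a b _ _ ha hb => rw [add_mul]; exact add_mem ha hb
    | smul c a _ ha => rw [smul_mul_assoc]; exact Submodule.smul_mem _ _ ha
  refine eq_top_iff.2 fun y _ => ?_
  obtain ⟨s, hs, t, ht, rfl⟩ := hA y
  have h0 := hM s (hR s hs) 0
  have h1 := hM t (hR t ht) 1
  simp at h0 h1
  exact add_mem h0 h1

end SkewAlgebra
end Tetra
namespace YetterDrinfeld

variable {k : Type u} {G : Type v} {V : Type w} [Field k] [Group G] [AddCommGroup V] [Module k V]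
  (Y : YetterDrinfeld k G V)

/-! ### Structures on the Nichols algebra -/

/-- The projection from the tensor algebra to the Nichols algebra. -/
noncomputable def nicholsMk : TensorAlgebra k V →ₐ[k] Y.NicholsAlgebra :=
  Ideal.Quotient.mkₐ k Y.nicholsIdeal

theorem nicholsMk_surjective : Function.Surjective Y.nicholsMk :=
  Ideal.Quotient.mkₐ_surjective k _

theorem nicholsMk_eq_zero {x : TensorAlgebra k V} : Y.nicholsMk x = 0 ↔ x ∈ Y.radical := by
  rw [← mem_nicholsIdeal]
  exact Ideal.Quotient.eq_zero_iff_mem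

@[simp]
theorem nicholsMk_ι (v : V) : Y.nicholsMk (TensorAlgebra.ι k v) = Y.nicholsι v := rfl

@[simp]
theorem nicholsCounit_nicholsMk (x : TensorAlgebra k V) :
    Y.nicholsCounit (Y.nicholsMk x) = TensorAlgebra.algebraMapInv x := rfl

/-- A linear map on the Nichols algebra defined by a linear map on the tensor algebra. -/
noncomputable def nicholsLift {M : Type*} [AddCommGroup M] [Module k M]
    (f : TensorAlgebra k V →ₗ[k] M) (hf : ∀ x ∈ Y.radical, f x = 0) : Y.NicholsAlgebra →ₗ[k] M :=
  (Y.nicholsIdeal.restrictScalars k).liftQ f (fun x hx => hf x (Y.mem_nicholsIdeal.1 hx)) ∘ₗ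
    (Submodule.Quotient.restrictScalarsEquiv k Y.nicholsIdeal).symm.toLinearMap

@[simp]
theorem nicholsLift_nicholsMk {M : Type*} [AddCommGroup M] [Module k M]
    (f : TensorAlgebra k V →ₗ[k] M) (hf : ∀ x ∈ Y.radical, f x = 0) (x : TensorAlgebra k V) :
    Y.nicholsLift f hf (Y.nicholsMk x) = f x := rfl

/-- The action of `g : G` on the Nichols algebra. -/
noncomputable def nicholsAction (g : G) : Y.NicholsAlgebra →ₐ[k] Y.NicholsAlgebra :=
  Ideal.Quotient.liftₐ Y.nicholsIdeal (Y.nicholsMk.comp (Y.tensorAction g)) fun _ hx =>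
    Y.nicholsMk_eq_zero.2 (tensorAction_mem_radical (Y.mem_nicholsIdeal.1 hx) g)

@[simp]
theorem nicholsAction_nicholsMk (g : G) (x : TensorAlgebra k V) :
    Y.nicholsAction g (Y.nicholsMk x) = Y.nicholsMk (Y.tensorAction g x) := rfl

@[simp]
theorem nicholsAction_nicholsι (g : G) (v : V) :
    Y.nicholsAction g (Y.nicholsι v) = Y.nicholsι (Y.action g v) := by
  rw [← nicholsMk_ι, nicholsAction_nicholsMk, tensorAction_ι, nicholsMk_ι]

/-- The skew derivation of the Nichols algebra for the linear form `v ↦ φ v_g`. -/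
noncomputable def nicholsDer (g : G) (φ : Module.Dual k V) :
    Y.NicholsAlgebra →ₗ[k] Y.NicholsAlgebra :=
  Y.nicholsLift (Y.nicholsMk.toLinearMap ∘ₗ Y.skewDer (Y.homDual g φ)) fun _ hx =>
    Y.nicholsMk_eq_zero.2 ((mem_radical_iff.1 hx).2 g φ)

@[simp]
theorem nicholsDer_nicholsMk (g : G) (φ : Module.Dual k V) (x : TensorAlgebra k V) :
    Y.nicholsDer g φ (Y.nicholsMk x) = Y.nicholsMk (Y.skewDer (Y.homDual g φ) x) := rfl

theorem nicholsDer_one (g : G) (φ : Module.Dual k V) : Y.nicholsDer g φ 1 = 0 := by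
  rw [← map_one Y.nicholsMk, nicholsDer_nicholsMk, skewDer_one, map_zero]

theorem nicholsDer_nicholsι_mul (g : G) (φ : Module.Dual k V) {h : G} {v : V}
    (hv : v ∈ Y.component h) (y : Y.NicholsAlgebra) :
    Y.nicholsDer g φ (Y.nicholsι v * y) = Y.nicholsι v * Y.nicholsDer g φ y +
      Y.homDual g φ v • Y.nicholsAction h y := by
  obtain ⟨x, rfl⟩ := Y.nicholsMk_surjective y
  rw [← nicholsMk_ι, ← map_mul, nicholsDer_nicholsMk, skewDer_ι_mul _ hv]
  simp

/-- Linearity of ∂_f in f: membership in the radical needs to be tested only on the dual basis. -/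
theorem skewDer_eq_sum_coord {ι : Type*} [Fintype ι] (e : Module.Basis ι k V)
    (f : Module.Dual k V) (x : TensorAlgebra k V) :
    Y.skewDer f x = ∑ i, f (e i) • Y.skewDer (e.coord i) x := by
  induction x using Y.induction_left with
  | one => simp
  | add x y hx hy => simp only [map_add, smul_add, Finset.sum_add_distrib, hx, hy]
  | smul c x hx =>
    simp only [map_smul, hx, Finset.smul_sum]
    exact Finset.sum_congr rfl fun i _ => smul_comm _ _ _
  | mul h v hv x hx =>
    have : f v = ∑ i, f (e i) * e.coord i v := by
      conv_lhs => rw [← e.sum_repr v, map_sum]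
      exact Finset.sum_congr rfl fun i _ => by rw [map_smul, smul_eq_mul, mul_comm]; rfl
    simp only [skewDer_ι_mul _ hv, smul_add, Finset.sum_add_distrib, hx, Finset.mul_sum,
      mul_smul_comm, smul_smul]
    rw [this, Finset.sum_smul]

theorem homDual_coord {ι : Type*} {γ : ι → G} (hγ : Function.Injective γ)
    (e : Module.Basis ι k V) (he : ∀ i, e i ∈ Y.component (γ i)) (i : ι) :
    Y.homDual (γ i) (e.coord i) = e.coord i := by
  refine e.ext fun j => ?_
  have hj : Y.coaction (e j) = Finsupp.single (γ j) (e j) := he j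
  by_cases h : j = i
  · subst h; simp [homDual, hj]
  · simp [homDual, hj, Finsupp.single_eq_of_ne (fun e => h (hγ e).symm),
      Finsupp.single_eq_of_ne (Ne.symm h)]

theorem eq_smul_of_mem_component {ι : Type*} [Fintype ι] {γ : ι → G}
    (hγ : Function.Injective γ) (e : Module.Basis ι k V) (he : ∀ i, e i ∈ Y.component (γ i)) {i : ι}
    {v : V} (hv : v ∈ Y.component (γ i)) : v = e.coord i v • e i := by
  have hv' : Y.coaction v = Finsupp.single (γ i) v := hv
  conv_lhs => rw [← e.sum_repr v]
  refine Finset.sum_eq_single i (fun j _ hj => ?_) (by simp)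
  have h := DFunLike.congr_fun (Y.homDual_coord hγ e he j) v
  have h0 : e.coord j v = 0 := by
    rw [← h]
    simp [homDual, hv', Finsupp.single_eq_of_ne fun e => hj (hγ e)]
  rw [← e.coord_apply, h0, zero_smul]

theorem nicholsAlgebra_eq_zero {ι : Type*} [Fintype ι] {γ : ι → G} (hγ : Function.Injective γ)
    (e : Module.Basis ι k V) (he : ∀ i, e i ∈ Y.component (γ i)) (y : Y.NicholsAlgebra)
    (h₀ : Y.nicholsCounit y = 0) (h₁ : ∀ i, Y.nicholsDer (γ i) (e.coord i) y = 0) : y = 0 := by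
  obtain ⟨x, rfl⟩ := Y.nicholsMk_surjective y
  rw [nicholsMk_eq_zero, mem_radical_iff]
  refine ⟨h₀, fun g φ => ?_⟩
  rw [Y.skewDer_eq_sum_coord e]
  refine Submodule.sum_mem _ fun i _ => Submodule.smul_mem _ _ ?_
  have := h₁ i
  rwa [nicholsDer_nicholsMk, nicholsMk_eq_zero, Y.homDual_coord hγ e he] at this

/-! ### The grading of the Nichols algebra -/

theorem nicholsMk_mem_nicholsPart {n : ℕ} {x : TensorAlgebra k V} (hx : x ∈ tensorPart k V n) :
    Y.nicholsMk x ∈ Y.nicholsPart n := ⟨x, hx, rfl⟩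

theorem nicholsι_mem_nicholsPart (v : V) : Y.nicholsι v ∈ Y.nicholsPart 1 :=
  Y.nicholsMk_mem_nicholsPart (by rw [tensorPart, pow_one]; exact ⟨v, rfl⟩)

theorem one_mem_nicholsPart : (1 : Y.NicholsAlgebra) ∈ Y.nicholsPart 0 := by
  rw [← map_one Y.nicholsMk]
  exact Y.nicholsMk_mem_nicholsPart (by rw [tensorPart, pow_zero]; exact Submodule.one_le.1 le_rfl)

variable {Y} in
theorem mul_mem_nicholsPart {m n : ℕ} {x y : Y.NicholsAlgebra} (hx : x ∈ Y.nicholsPart m)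
    (hy : y ∈ Y.nicholsPart n) : x * y ∈ Y.nicholsPart (m + n) := by
  obtain ⟨x, hx, rfl⟩ := hx
  obtain ⟨y, hy, rfl⟩ := hy
  refine ⟨x * y, ?_, map_mul Y.nicholsMk x y⟩
  rw [tensorPart, pow_add]
  exact Submodule.mul_mem_mul hx hy

theorem nicholsMonomial_cons {ι : Type*} (v : ι → V) (i : ι) (l : List ι) :
    Y.nicholsMonomial v (i :: l) = Y.nicholsι (v i) * Y.nicholsMonomial v l := by
  simp [nicholsMonomial]

theorem nicholsMonomial_mem_nicholsPart {ι : Type*} (v : ι → V) (l : List ι) :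
    Y.nicholsMonomial v l ∈ Y.nicholsPart l.length := by
  induction l with
  | nil => exact Y.one_mem_nicholsPart
  | cons i l ih =>
    rw [nicholsMonomial_cons, List.length_cons, add_comm]
    exact mul_mem_nicholsPart (Y.nicholsι_mem_nicholsPart _) ih

/-- The projection to the homogeneous component of degree `n`. -/
noncomputable def nicholsProj (n : ℕ) : Y.NicholsAlgebra →ₗ[k] Y.NicholsAlgebra :=
  Y.nicholsLift (Y.nicholsMk.toLinearMap ∘ₗ GradedAlgebra.proj (tensorPart k V) n) fun x hx => by
    rw [LinearMap.comp_apply, GradedAlgebra.proj_apply]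
    exact Y.nicholsMk_eq_zero.2 (decompose_mem_radical hx n)

variable {Y} in
theorem nicholsProj_of_mem {m : ℕ} {y : Y.NicholsAlgebra} (hy : y ∈ Y.nicholsPart m) (n : ℕ) :
    Y.nicholsProj n y = if m = n then y else 0 := by
  obtain ⟨x, hx, rfl⟩ := hy
  change Y.nicholsProj n (Y.nicholsMk x) = if m = n then Y.nicholsMk x else 0
  rw [nicholsProj, nicholsLift_nicholsMk, LinearMap.comp_apply, GradedAlgebra.proj_apply]
  split_ifs with h
  · subst h; rw [DirectSum.decompose_of_mem_same _ hx]; rfl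
  · rw [DirectSum.decompose_of_mem_ne _ hx h, map_zero]

theorem finrank_nicholsPart_eq_card {ι : Type*} [Fintype ι]
    (b : Module.Basis ι k Y.NicholsAlgebra) (deg : ι → ℕ)
    (hb : ∀ i, b i ∈ Y.nicholsPart (deg i)) (n : ℕ) :
    Module.finrank k (Y.nicholsPart n) = Fintype.card {i // deg i = n} := by
  classical
  have : Y.nicholsPart n = Submodule.span k (Set.range fun i : {i // deg i = n} => b i) := by
    apply le_antisymm
    · intro y hy
      have h1 : y = Y.nicholsProj n y := by rw [nicholsProj_of_mem hy, if_pos rfl]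
      rw [h1, ← b.sum_repr y, map_sum]
      refine Submodule.sum_mem _ fun i _ => ?_
      rw [map_smul, nicholsProj_of_mem (hb i)]
      split_ifs with h
      · exact Submodule.smul_mem _ _ (Submodule.subset_span ⟨⟨i, h⟩, rfl⟩)
      · simp
    · rw [Submodule.span_le]
      rintro _ ⟨⟨i, rfl⟩, rfl⟩
      exact hb i
  rw [this]
  exact finrank_span_eq_card (b.linearIndependent.comp _ Subtype.val_injective)

theorem hilbertSeries_eq_sum {ι : Type*} [Fintype ι]
    (b : Module.Basis ι k Y.NicholsAlgebra) (deg : ι → ℕ)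
    (hb : ∀ i, b i ∈ Y.nicholsPart (deg i)) :
    Y.hilbertSeries = ∑ i, (PowerSeries.X : PowerSeries ℕ) ^ deg i := by
  classical
  ext n
  rw [hilbertSeries, PowerSeries.coeff_mk, Y.finrank_nicholsPart_eq_card b deg hb, map_sum,
    Fintype.card_subtype, Finset.card_filter]
  refine Finset.sum_congr rfl fun i _ => ?_
  rw [PowerSeries.coeff_X_pow]
  simp only [eq_comm]

theorem nicholsPart_eq_bot {ι : Type*} [Fintype ι]
    (b : Module.Basis ι k Y.NicholsAlgebra) (deg : ι → ℕ)
    (hb : ∀ i, b i ∈ Y.nicholsPart (deg i)) {n : ℕ} (hn : ∀ i, deg i ≠ n) :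
    Y.nicholsPart n = ⊥ := by
  rw [eq_bot_iff]
  intro y hy
  have h1 : y = Y.nicholsProj n y := by rw [nicholsProj_of_mem hy, if_pos rfl]
  rw [h1, ← b.sum_repr y, map_sum]
  refine Submodule.sum_mem _ fun i _ => ?_
  rw [map_smul, nicholsProj_of_mem (hb i), if_neg (hn i), smul_zero]
  exact zero_mem _

variable {Y} in
-- Nothing survives one degree higher, so every element of V annihilates Λ from both sides, and V
-- generates 𝔅(V).
theorem isIntegral_of_mem_nicholsPart {n : ℕ} {Λ : Y.NicholsAlgebra} (hΛ : Λ ∈ Y.nicholsPart n)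
    (h₀ : Λ ≠ 0) (hn : Y.nicholsPart (n + 1) = ⊥) : Y.IsIntegral Λ := by
  refine ⟨h₀, fun y => ?_⟩
  obtain ⟨x, rfl⟩ := Y.nicholsMk_surjective y
  rw [nicholsCounit_nicholsMk]
  induction x using TensorAlgebra.induction with
  | algebraMap r =>
    rw [AlgHom.commutes, AlgHom.commutes, ← Algebra.smul_def, ← Algebra.commutes,
      ← Algebra.smul_def]
    exact ⟨rfl, rfl⟩
  | ι v =>
    have h1 := mul_mem_nicholsPart hΛ (Y.nicholsι_mem_nicholsPart v)
    have h2 := mul_mem_nicholsPart (Y.nicholsι_mem_nicholsPart v) hΛ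
    rw [add_comm, hn, Submodule.mem_bot] at h2
    rw [hn, Submodule.mem_bot] at h1
    simp [h1, h2, TensorAlgebra.algebraMapInv]
  | mul a b ha hb =>
    rw [map_mul, map_mul, mul_assoc, hb.1, ← mul_assoc Λ, ha.2]
    simp only [smul_mul_assoc, mul_smul_comm, ha.1, hb.2, smul_smul, and_true]
    rw [mul_comm]
  | add a b ha hb =>
    rw [map_add, map_add, add_mul, mul_add, ha.1, ha.2, hb.1, hb.2, add_smul]
    exact ⟨rfl, rfl⟩

/-! ### Nichols algebras of tetrahedral type -/

/-- The algebra with skew derivations given by a Yetter-Drinfeld module with a homogeneous basis `e`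
indexed by the tetrahedron rack, on which `G` acts by `γ i · e j = - e (i ◃ j)`. -/
noncomputable def skewAlgebra {γ : Tetra → G} (hγ : Function.Injective γ)
    (e : Module.Basis Tetra k V) (he : ∀ i, e i ∈ Y.component (γ i))
    (ha : ∀ i j, Y.action (γ i) (e j) = - e (i ◃ j)) : Tetra.SkewAlgebra k Y.NicholsAlgebra where
  v i := Y.nicholsι (e i)
  g i := Y.nicholsAction (γ i)
  D i := Y.nicholsDer (γ i) (e.coord i)
  ε := Y.nicholsCounit
  adjoin_v := by
    rw [eq_top_iff]
    intro y _
    obtain ⟨x, rfl⟩ := Y.nicholsMk_surjective y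
    induction x using TensorAlgebra.induction with
    | algebraMap r => rw [AlgHom.commutes]; exact Subalgebra.algebraMap_mem _ r
    | ι v =>
      rw [nicholsMk_ι, ← e.sum_repr v, map_sum]
      refine Subalgebra.sum_mem _ fun i _ => ?_
      rw [map_smul]
      exact Subalgebra.smul_mem _ (Algebra.subset_adjoin (Set.mem_range_self i)) _
    | mul a b ha hb => rw [map_mul]; exact mul_mem (ha trivial) (hb trivial)
    | add a b ha hb => rw [map_add]; exact add_mem (ha trivial) (hb trivial)
  g_v i j := by rw [nicholsAction_nicholsι, ha, map_neg]
  D_one i := Y.nicholsDer_one _ _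
  D_v_mul i j y := by
    rw [Y.nicholsDer_nicholsι_mul _ _ (he j), Y.homDual_coord hγ e he]
    by_cases h : i = j
    · subst h; simp
    · simp [h, Finsupp.single_eq_of_ne h]
  ε_v i := by
    rw [← nicholsMk_ι, nicholsCounit_nicholsMk]
    simp [TensorAlgebra.algebraMapInv]
  eq_zero y h₀ h₁ := Y.nicholsAlgebra_eq_zero hγ e he y h₀ h₁

theorem skewAlgebra_word {γ : Tetra → G} (hγ : Function.Injective γ)
    (e : Module.Basis Tetra k V) (he : ∀ i, e i ∈ Y.component (γ i))
    (ha : ∀ i j, Y.action (γ i) (e j) = - e (i ◃ j)) (l : List Tetra) :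
    (Y.skewAlgebra hγ e he ha).word l = Y.nicholsMonomial e l := rfl

theorem _root_.Tetra.length_basisWord {n : ℕ} (hn : n ≤ 6)
    (p : ((Fin 2 × Fin 3) × Fin n) × Fin 2) :
    (Tetra.basisWord n p).length = p.1.1.1 + p.1.1.2 + p.1.2 + p.2 := by
  obtain ⟨⟨⟨i, j⟩, l⟩, m⟩ := p
  simp only [Tetra.basisWord, Tetra.wordF, Tetra.wordP, List.length_append, List.length_take,
    List.length_cons, List.length_nil]
  omega

theorem _root_.Tetra.sum_X_pow_length_basisWord {n : ℕ} (hn : n ≤ 6) :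
    ∑ p, (PowerSeries.X : PowerSeries ℕ) ^ (Tetra.basisWord n p).length =
      tNumber 2 ^ 2 * tNumber 3 * tNumber n := by
  simp only [Tetra.length_basisWord hn, Fintype.sum_prod_type, pow_add, ← Finset.mul_sum,
    ← Finset.sum_mul, tNumber, ← Fin.sum_univ_eq_sum_range]
  ring

theorem nicholsAlgebra_of_basisWord {γ : Tetra → G} (hγ : Function.Injective γ)
    (e : Module.Basis Tetra k V) (he : ∀ i, e i ∈ Y.component (γ i))
    (ha : ∀ i j, Y.action (γ i) (e j) = - e (i ◃ j)) {n : ℕ} (hn : n ≤ 6) (hn' : n ≠ 0)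
    (hli : LinearIndependent k
      fun p => (Y.skewAlgebra hγ e he ha).word (Tetra.basisWord n p))
    (hsp : Submodule.span k
      (Set.range fun p => (Y.skewAlgebra hγ e he ha).word (Tetra.basisWord n p)) = ⊤) :
    Y.hilbertSeries = tNumber 2 ^ 2 * tNumber 3 * tNumber n ∧
    Module.finrank k Y.NicholsAlgebra = 12 * n ∧
    ∀ v : Tetra → V, (∀ i, v i ∈ Y.component (γ i) ∧ v i ≠ 0) →
      Y.IsIntegral (Y.nicholsMonomial v
        ([.p1, .p2, .p1] ++ Tetra.wordP (n - 1) ++ [.p3])) := by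
  let b := Module.Basis.mk hli hsp.ge
  have hbp : ∀ p, b p = Y.nicholsMonomial e (Tetra.basisWord n p) := fun p => by
    simp [b, skewAlgebra_word]
  have hb : ∀ p, b p ∈ Y.nicholsPart (Tetra.basisWord n p).length := fun p => by
    rw [hbp]; exact Y.nicholsMonomial_mem_nicholsPart _ _
  refine ⟨?_, ?_, fun v hv => ?_⟩
  · rw [Y.hilbertSeries_eq_sum b _ hb, Tetra.sum_X_pow_length_basisWord hn]
  · rw [Module.finrank_eq_card_basis b]
    simp; ring
  · refine isIntegral_of_mem_nicholsPart (Y.nicholsMonomial_mem_nicholsPart _ _) ?_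
      (Y.nicholsPart_eq_bot b _ hb fun p => ?_)
    · have hc : ∀ i, ∃ c : k, v i = c • e i := fun i =>
        ⟨_, Y.eq_smul_of_mem_component hγ e he (hv i).1⟩
      choose c hc using hc
      have hc0 : ∀ i, c i ≠ 0 := fun i h => (hv i).2 (by rw [hc, h, zero_smul])
      have hmon : ∀ l : List Tetra, ∃ a : k, a ≠ 0 ∧
          Y.nicholsMonomial v l = a • Y.nicholsMonomial e l := by
        intro l
        induction l with
        | nil => exact ⟨1, one_ne_zero, by simp [nicholsMonomial]⟩
        | cons i l ih =>
          obtain ⟨a, ha, h⟩ := ih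
          refine ⟨c i * a, mul_ne_zero (hc0 i) ha, ?_⟩
          rw [nicholsMonomial_cons, nicholsMonomial_cons, h, hc, map_smul, smul_mul_smul_comm]
      obtain ⟨a, ha, h⟩ := hmon ([.p1, .p2, .p1] ++ Tetra.wordP (n - 1) ++ [.p3])
      rw [h]
      refine smul_ne_zero ha ?_
      -- All four exponents are maximal here, so this is the longest basis word.
      have := b.ne_zero (((1, 2), ⟨n - 1, by omega⟩), 1)
      rwa [hbp] at this
    · rw [Tetra.length_basisWord hn]
      obtain ⟨⟨⟨i, j⟩, l⟩, m⟩ := p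
      simp only [Tetra.wordP, List.length_append, List.length_take,
        List.length_cons, List.length_nil]
      omega

end YetterDrinfeld
/-! ### The enveloping group of the tetrahedron rack -/

theorem Rack.EnvelGroup.closure_range (R : Type*) [Rack R] :
    Subgroup.closure (Set.range (Rack.toEnvelGroup R : R → Rack.EnvelGroup R)) = ⊤ := by
  rw [eq_top_iff]
  intro g _
  induction g using Quotient.inductionOn with
  | h a =>
    induction a with
    | unit => exact one_mem _
    | incl x => exact Subgroup.subset_closure ⟨x, rfl⟩
    | mul a b ha hb => exact mul_mem (ha trivial) (hb trivial)
    | inv a ha => exact inv_mem (ha trivial)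

namespace Tetra

/-- The enveloping group acts on the rack, and distinct elements of this rack act by distinct
permutations. -/
theorem x_injective : Function.Injective x := by
  intro i j h
  have : ∀ m, i ◃ m = j ◃ m := fun m => by
    rw [← Rack.envelAction_prop, ← Rack.envelAction_prop]
    exact congrArg (fun g => Rack.envelAction g m) h
  clear h
  revert i j
  decide

theorem x_relations :
    (x p1 * x p2 = x p4 * x p1 ∧ x p1 * x p3 = x p2 * x p1 ∧ x p1 * x p4 = x p3 * x p1) ∧
    (x p2 * x p1 = x p3 * x p2 ∧ x p2 * x p3 = x p4 * x p2 ∧ x p2 * x p4 = x p1 * x p2) ∧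
    (x p3 * x p1 = x p4 * x p3 ∧ x p3 * x p2 = x p1 * x p3 ∧ x p3 * x p4 = x p2 * x p3) ∧
    (x p4 * x p1 = x p2 * x p4 ∧ x p4 * x p2 = x p3 * x p4 ∧ x p4 * x p3 = x p1 * x p4) :=
  ⟨⟨x_mul_x p1 p2, x_mul_x p1 p3, x_mul_x p1 p4⟩, ⟨x_mul_x p2 p1, x_mul_x p2 p3, x_mul_x p2 p4⟩,
    ⟨x_mul_x p3 p1, x_mul_x p3 p2, x_mul_x p3 p4⟩, ⟨x_mul_x p4 p1, x_mul_x p4 p2, x_mul_x p4 p3⟩⟩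

/-! ### Cosets and generators of the centralizer -/

/-- Representatives of the left cosets of the centralizer of `x p1`. -/
def cosetRep : Tetra → EnvGroup
  | p1 => 1
  | p2 => x p4
  | p3 => x p2
  | p4 => x p3

theorem cosetRep_mul_x1 (i : Tetra) : cosetRep i * x p1 = x i * cosetRep i := by
  obtain ⟨-, h2, h3, h4⟩ := x_relations
  cases i <;> simp [cosetRep, h2.1, h3.1, h4.1]

/-- The elements `q i j` of the centralizer with `x i * cosetRep j = cosetRep (i ◃ j) * q i j`. -/
def cocycle : Tetra → Tetra → C
  | p1, _ => x1
  | p2, p1 => 1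
  | p2, p2 => x1
  | p2, p3 => x4x2 * x1⁻¹
  | p2, p4 => x4x2
  | p3, p1 => 1
  | p3, p2 => x4x2
  | p3, p3 => x1
  | p3, p4 => x4x2 * x1⁻¹
  | p4, p1 => 1
  | p4, p2 => x4x2 * x1⁻¹
  | p4, p3 => x4x2
  | p4, p4 => x1

theorem x_mul_cosetRep (i j : Tetra) :
    x i * cosetRep j = cosetRep (i ◃ j) * (cocycle i j : EnvGroup) := by
  obtain ⟨⟨h12, h13, h14⟩, ⟨h21, h23, h24⟩, ⟨h31, h32, h34⟩, ⟨h41, h42, h43⟩⟩ := x_relations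
  -- The three identities behind the values x₄x₂x₁⁻¹ of the cocycle, with x₁⁻¹ cleared.
  have e42 : x p4 * x p4 * x p1 = x p2 * (x p4 * x p2) :=
    calc x p4 * x p4 * x p1 = x p4 * (x p2 * x p4) := by rw [mul_assoc, h41]
      _ = x p4 * x p1 * x p2 := by rw [h24, mul_assoc]
      _ = x p2 * (x p4 * x p2) := by rw [h41, mul_assoc]
  have e23 : x p2 * x p2 * x p1 = x p3 * (x p4 * x p2) :=
    calc x p2 * x p2 * x p1 = x p2 * x p3 * x p2 := by rw [mul_assoc, h21, mul_assoc]
      _ = x p3 * (x p4 * x p2) := by rw [h23, h42, mul_assoc, h42]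
  have e34 : x p3 * x p3 * x p1 = x p4 * (x p4 * x p2) :=
    calc x p3 * x p3 * x p1 = x p3 * (x p4 * x p3) := by rw [mul_assoc, h31]
      _ = x p3 * x p1 * x p4 := by rw [h43, mul_assoc]
      _ = x p4 * (x p4 * x p2) := by rw [h31, mul_assoc, h42]
  cases i <;> cases j <;> simp only [cosetRep, cocycle, act_table, x1, x4x2, Subgroup.coe_mul,
    Subgroup.coe_inv, Subgroup.coe_one, one_mul, mul_one]
  all_goals first
    | assumption
    | exact h42.symm
    | exact h24.trans h12
    | exact h32.trans h13
    | exact h43.trans h14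
    | (rw [← mul_assoc, eq_mul_inv_iff_mul_eq]; assumption)

/-- The subgroup of the centralizer of `x p1` generated by `x p1` and `x p4 * x p2`. -/
def genC : Subgroup C := Subgroup.closure {x1, x4x2}

theorem x1_mem_genC : x1 ∈ genC := Subgroup.subset_closure (Set.mem_insert _ _)

theorem x4x2_mem_genC : x4x2 ∈ genC :=
  Subgroup.subset_closure (Set.mem_insert_of_mem _ (Set.mem_singleton _))

theorem cocycle_mem_genC (i j : Tetra) : cocycle i j ∈ genC := by
  have h := mul_mem x4x2_mem_genC (inv_mem x1_mem_genC)
  cases i <;> cases j <;>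
    first | exact x1_mem_genC | exact x4x2_mem_genC | exact h | exact one_mem _

theorem exists_eq_cosetRep_mul (g : EnvGroup) : ∃ i, ∃ c ∈ genC, g = cosetRep i * c := by
  have hg : g ∈ Subgroup.closure (Set.range x) := by
    rw [show Set.range x = Set.range (Rack.toEnvelGroup Tetra : Tetra → EnvGroup) from rfl,
      Rack.EnvelGroup.closure_range]
    trivial
  induction hg using Subgroup.closure_induction_left with
  | one => exact ⟨p1, 1, one_mem _, by simp [cosetRep]⟩
  | mul_left y hy z _ ih =>
    obtain ⟨i, rfl⟩ := hy
    obtain ⟨j, c, hc, rfl⟩ := ih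
    exact ⟨i ◃ j, cocycle i j * c, mul_mem (cocycle_mem_genC i j) hc, by
      rw [← mul_assoc, x_mul_cosetRep, Subgroup.coe_mul, mul_assoc]⟩
  | inv_mul_cancel y hy z _ ih =>
    obtain ⟨i, rfl⟩ := hy
    obtain ⟨j, c, hc, rfl⟩ := ih
    refine ⟨i ◃⁻¹ j, (cocycle i (i ◃⁻¹ j))⁻¹ * c, mul_mem (inv_mem (cocycle_mem_genC _ _)) hc, ?_⟩
    have := x_mul_cosetRep i (i ◃⁻¹ j)
    rw [Rack.act_invAct_eq] at this
    rw [inv_mul_eq_iff_eq_mul, ← mul_assoc, this, Subgroup.coe_mul, Subgroup.coe_inv]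
    group

/-- If t_i c centralizes x₁, then conjugating x₁ by it gives x_i = x₁. Hence i = 1 and the element
is c. -/
theorem genC_eq_top : genC = ⊤ := by
  rw [eq_top_iff]
  rintro ⟨g, hg⟩ -
  obtain ⟨i, c, hc, rfl⟩ := exists_eq_cosetRep_mul g
  have h1 : x p1 * (cosetRep i * c) = cosetRep i * c * x p1 :=
    Subgroup.mem_centralizer_iff.1 hg _ rfl
  have h2 : x p1 * (c : EnvGroup) = c * x p1 := Subgroup.mem_centralizer_iff.1 c.2 _ rfl
  rw [mul_assoc, ← h2, ← mul_assoc, ← mul_assoc, mul_left_inj, cosetRep_mul_x1, mul_left_inj] at h1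
  obtain rfl := x_injective h1
  have : (⟨cosetRep p1 * c, hg⟩ : C) = c := Subtype.ext (by simp [cosetRep])
  rwa [this]

theorem C_mul_comm (a b : C) : a * b = b * a := by
  have h : x1 * x4x2 = x4x2 * x1 :=
    Subtype.ext (Subgroup.mem_centralizer_iff.1 x4x2.2 _ rfl)
  have hcomm : ∀ y ∈ ({x1, x4x2} : Set C), ∀ z ∈ ({x1, x4x2} : Set C), y * z = z * y := by
    rintro y (rfl | rfl) z (rfl | rfl)
    · rfl
    · exact h
    · exact h.symm
    · rfl
  have := Subgroup.isMulCommutative_closure hcomm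
  have ha : a ∈ Subgroup.closure ({x1, x4x2} : Set C) :=
    (genC_eq_top ▸ Subgroup.mem_top a : a ∈ genC)
  have hb : b ∈ Subgroup.closure ({x1, x4x2} : Set C) :=
    (genC_eq_top ▸ Subgroup.mem_top b : b ∈ genC)
  exact Subtype.ext_iff.1 (this.is_comm.comm ⟨a, ha⟩ ⟨b, hb⟩)

instance : Group.FG C := Group.fg_iff.2 ⟨{x1, x4x2}, genC_eq_top, by simp⟩

end Tetra

/-! ### Absolutely simple representations of commutative groups -/

open scoped MonoidAlgebra in
theorem Representation.finrank_eq_one_of_isAlgClosed {K Γ W : Type*} [Field K] [IsAlgClosed K]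
    [CommGroup Γ] [Group.FG Γ] [AddCommGroup W] [Module K W] (ρ : Representation K Γ W)
    (hρ : ρ.IsIrreducible) : Module.finrank K W = 1 := by
  rw [Representation.irreducible_iff_isSimpleModule_asModule,
    isSimpleModule_iff_quot_maximal] at hρ
  obtain ⟨m, hm, ⟨e⟩⟩ := hρ
  let _ : Field (K[Γ] ⧸ m) := Ideal.Quotient.field m
  have : Algebra.FiniteType K (K[Γ] ⧸ m) := inferInstance
  -- Zariski's lemma replaces any finiteness assumption on W: a field finitely generated as a
  -- K-algebra is finite over K, hence equal to K.
  have : Module.Finite K (K[Γ] ⧸ m) := finite_of_finite_type_of_isJacobsonRing K _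
  have hb := IsAlgClosed.algebraMap_bijective_of_isIntegral (k := K) (K := K[Γ] ⧸ m)
  let e' := (ρ.asModuleEquiv.symm.trans (e.restrictScalars K)).trans
    (LinearEquiv.ofBijective (Algebra.linearMap K (K[Γ] ⧸ m)) hb).symm
  rw [e'.finrank_eq, Module.finrank_self]

theorem Representation.IsAbsolutelySimple.finrank_eq_one {k : Type u} {Γ : Type v} {W : Type w}
    [Field k] [Group Γ] [Group.FG Γ] (hΓ : ∀ a b : Γ, a * b = b * a) [AddCommGroup W] [Module k W]
    {ρ : Representation k Γ W} (hρ : ρ.IsAbsolutelySimple) : Module.finrank k W = 1 := by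
  let K := AlgebraicClosure k
  let _ : CommGroup Γ := { mul_comm := hΓ }
  have := Representation.finrank_eq_one_of_isAlgClosed (ρ.extendScalars K) (hρ K)
  rwa [Module.finrank_baseChange] at this
/-! ### Induced Yetter-Drinfeld modules -/

namespace YetterDrinfeld

section Induced

variable {k : Type u} {G : Type v} {W : Type w} [Field k] [Group G] [AddCommGroup W] [Module k W]
  (g : G) (ρ : Representation k (Subgroup.centralizer {g}) W)

theorem inducedMk_mul (h : G) (c : Subgroup.centralizer {g}) (w : W) :
    inducedMk g ρ (h * c) w = inducedMk g ρ h (ρ c w) := by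
  have key := Representation.Coinvariants.mk_self_apply (Representation.tprod
    ((Representation.leftRegular k G).comp (Subgroup.centralizer {g}).subtype) ρ) c⁻¹
    ((MonoidAlgebra.single h⁻¹ 1) ⊗ₜ (ρ c w))
  simpa [inducedMk] using key

open scoped Classical in
/-- The map from the induced module to `W` which is `c ⊗ w ↦ c w` for `c` in the centralizer and
zero on all other cosets. -/
noncomputable def inducedProj : InducedSpace g ρ →ₗ[k] W :=
  Representation.Coinvariants.lift _
    (TensorProduct.lift ((Finsupp.lsum k fun h : G => LinearMap.toSpanSingleton k _
        (if hh : h ∈ Subgroup.centralizer {g} then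
          ρ (⟨h, hh⟩ : Subgroup.centralizer {g})⁻¹ else 0)) ∘ₗ
      (MonoidAlgebra.coeffLinearEquiv k).toLinearMap))
    (fun c => by
      ext h w : 4
      by_cases hh : h ∈ Subgroup.centralizer {g}
      · have hc : (c : G) * h ∈ Subgroup.centralizer {g} := mul_mem c.2 hh
        have e : (⟨(c : G) * h, hc⟩ : Subgroup.centralizer {g}) = c * ⟨h, hh⟩ := rfl
        simp [hh, hc, e]
      · have hc : (c : G) * h ∉ Subgroup.centralizer {g} := fun hc =>
          hh (by simpa using mul_mem (inv_mem c.2) hc)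
        simp [hh, hc])

theorem inducedProj_inducedMk_one (w : W) : inducedProj g ρ (inducedMk g ρ 1 w) = w := by
  have h1 : (⟨1, one_mem _⟩ : Subgroup.centralizer {g}) = 1 := rfl
  simp [inducedProj, inducedMk, one_mem, h1]

/-- Translate by h⁻¹ to the trivial coset and project onto it. This is what makes the coset vectors
nonzero. -/
theorem inducedMk_injective (h : G) : Function.Injective (inducedMk g ρ h) := by
  intro u v huv
  have := congrArg (fun y => inducedProj g ρ
    (Representation.ind (Subgroup.centralizer {g}).subtype ρ h⁻¹ y)) huv
  simpa only [ind_inducedMk, inv_mul_cancel, inducedProj_inducedMk_one] using this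

end Induced

variable {k : Type u} {G : Type v} {V : Type w} [Field k] [Group G] [AddCommGroup V] [Module k V]
  (Y : YetterDrinfeld k G V)

theorem linearIndependent_of_mem_component {ι : Type*} [Fintype ι] {γ : ι → G}
    (hγ : Function.Injective γ) {e : ι → V} (he : ∀ i, e i ∈ Y.component (γ i))
    (h0 : ∀ i, e i ≠ 0) : LinearIndependent k e := by
  rw [Fintype.linearIndependent_iff]
  intro c hc i
  have he' : ∀ j, Y.coaction (e j) = Finsupp.single (γ j) (e j) := he
  have := DFunLike.congr_fun (congrArg Y.coaction hc) (γ i)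
  simp only [map_sum, map_smul, he', Finsupp.coe_finsetSum, Finset.sum_apply, Finsupp.smul_apply,
    map_zero, Finsupp.zero_apply] at this
  rw [Finset.sum_eq_single i] at this
  · simpa [h0 i] using this
  · intro j _ hj
    rw [Finsupp.single_eq_of_ne fun e => hj (hγ e).symm, smul_zero]
  · simp

/-! ### The degree two part of the Nichols algebra -/

theorem nicholsDer_nicholsι (g : G) (φ : Module.Dual k V) (v : V) :
    Y.nicholsDer g φ (Y.nicholsι v) = algebraMap k _ (Y.homDual g φ v) := by
  rw [← nicholsMk_ι, nicholsDer_nicholsMk, skewDer_ι, AlgHom.commutes]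

theorem nicholsι_injective : Function.Injective Y.nicholsι := by
  rw [← LinearMap.ker_eq_bot, eq_bot_iff]
  intro v hv
  have h : ∀ g φ, Y.homDual g φ v = 0 := fun g φ => by
    have := congrArg (fun y => Y.nicholsCounit (Y.nicholsDer g φ y)) (LinearMap.mem_ker.1 hv)
    simpa only [nicholsDer_nicholsι, AlgHom.commutes, map_zero,
      Algebra.algebraMap_self, RingHom.id_apply] using this
  have hc : Y.coaction v = 0 := by
    ext g
    rw [Finsupp.zero_apply, ← Module.forall_dual_apply_eq_zero_iff k]
    exact h g
  rw [Submodule.mem_bot, ← Y.counit_coaction v, hc]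
  simp

instance finite_nicholsPart [Module.Finite k V] (n : ℕ) : Module.Finite k (Y.nicholsPart n) := by
  have h : (LinearMap.range (TensorAlgebra.ι k : V →ₗ[k] TensorAlgebra k V)).FG :=
    Module.Finite.iff_fg.1 inferInstance
  exact Module.Finite.iff_fg.2 ((h.pow n).map _)

/-- A lower bound for the rank of `1 + c` on `V ⊗ V`, for a Yetter-Drinfeld module of rack type. -/
theorem card_le_finrank_nicholsPart_two {γ : Tetra → G} (hγ : Function.Injective γ)
    (e : Module.Basis Tetra k V) (he : ∀ i, e i ∈ Y.component (γ i)) (a : Tetra → Tetra → k)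
    (ha : ∀ i j, Y.action (γ i) (e j) = a i j • e (i ◃ j)) (s : Finset (Tetra × Tetra))
    (hs : ∀ c : Tetra × Tetra → k, (∀ p ∉ s, c p = 0) →
      (∀ i j, c (i ◃ j, i) + a i j * c (i, j) = 0) → c = 0) :
    s.card ≤ Module.finrank k (Y.nicholsPart 2) := by
  have : Module.Finite k V := Module.Finite.of_basis e
  let y : s → Y.nicholsPart 2 := fun p => ⟨Y.nicholsι (e p.1.1) * Y.nicholsι (e p.1.2),
    mul_mem_nicholsPart (Y.nicholsι_mem_nicholsPart _) (Y.nicholsι_mem_nicholsPart _)⟩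
  have hy : LinearIndependent k y := by
    rw [Fintype.linearIndependent_iff]
    intro c hc
    let c' : Tetra × Tetra → k := fun p => if hp : p ∈ s then c ⟨p, hp⟩ else 0
    have hc' : ∑ p : Tetra × Tetra, c' p • (Y.nicholsι (e p.1) * Y.nicholsι (e p.2)) = 0 := by
      have := congrArg (Y.nicholsPart 2).subtype hc
      rw [map_sum, map_zero] at this
      rw [← this, ← Finset.sum_subset (Finset.subset_univ s), ← Finset.sum_coe_sort s]
      · refine Finset.sum_congr rfl fun p _ => ?_
        simp [c', y]
      · intro p _ hp
        simp [c', hp]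
    have h0 : c' = 0 := by
      -- The equation required is the coefficient of e_{i▷j} in D_i of the relation, that is, the
      -- (i▷j, i) entry of 1 + c.
      refine hs c' (fun p hp => by simp [c', hp]) fun i j => ?_
      have h1 := congrArg (Y.nicholsDer (γ i) (e.coord i)) hc'
      have h2 : Y.nicholsι (∑ p : Tetra × Tetra, c' p • (e.coord i (e p.2) • e p.1 +
          (e.coord i (e p.1) * a p.1 p.2) • e (p.1 ◃ p.2))) = 0 := by
        rw [map_zero, map_sum] at h1
        rw [map_sum, ← h1]
        refine Finset.sum_congr rfl fun p _ => ?_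
        rw [map_smul, map_smul, map_add, map_smul, map_smul, Y.nicholsDer_nicholsι_mul _ _ (he _),
          nicholsDer_nicholsι, Y.homDual_coord hγ e he, nicholsAction_nicholsι, ha, map_smul,
          smul_smul, ← Algebra.commutes, ← Algebra.smul_def]
      have h3 := congrArg (e.coord (i ◃ j))
        ((map_eq_zero_iff Y.nicholsι Y.nicholsι_injective).1 h2)
      simpa [Fintype.sum_prod_type, Finsupp.single_apply, mul_add, Finset.sum_add_distrib,
        Rack.left_cancel, mul_comm] using h3
    intro p
    have := congrFun h0 p
    simpa [c'] using this
  simpa using hy.fintype_card_le_finrank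

end YetterDrinfeld
namespace Tetra

variable {k : Type u} [Field k] {W : Type w} [AddCommGroup W] [Module k W]
  (ρ : Representation k C W)

/-! ### The Yetter-Drinfeld module of the tetrahedron rack -/

/-- The vectors `t_i ⊗ w` of `M(x₁, ρ)` for the coset representatives `t_i`. -/
noncomputable def cosetVec (i : Tetra) : W →ₗ[k] V ρ :=
  YetterDrinfeld.inducedMk (x p1) ρ (cosetRep i)

theorem cosetVec_mem_component (i : Tetra) (w : W) :
    cosetVec ρ i w ∈ (M ρ).component (x i) := by
  have h : cosetRep i * x p1 * (cosetRep i)⁻¹ = x i := by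
    rw [cosetRep_mul_x1, mul_inv_cancel_right]
  have := YetterDrinfeld.inducedCoaction_mk (x p1) ρ (cosetRep i) w
  rw [h] at this
  exact this

theorem action_cosetVec (i j : Tetra) (w : W) :
    (M ρ).action (x i) (cosetVec ρ j w) = cosetVec ρ (i ◃ j) (ρ (cocycle i j) w) := by
  have := YetterDrinfeld.ind_inducedMk (x p1) ρ (x i) (cosetRep j) w
  rw [x_mul_cosetRep, YetterDrinfeld.inducedMk_mul] at this
  exact this

variable {ρ} in
theorem cosetVec_ne_zero {w : W} (hw : w ≠ 0) (i : Tetra) : cosetVec ρ i w ≠ 0 :=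
  (map_ne_zero_iff _ (YetterDrinfeld.inducedMk_injective _ ρ _)).2 hw

theorem span_cosetVec {w : W} (hw : ∀ u : W, ∃ c : k, c • w = u) :
    Submodule.span k (Set.range fun i => cosetVec ρ i w) = ⊤ := by
  set S := Submodule.span k (Set.range fun i => cosetVec ρ i w)
  suffices h : S.mkQ = 0 by rw [← Submodule.ker_mkQ S, h, LinearMap.ker_zero]
  refine YetterDrinfeld.induced_hom_ext _ ρ fun t u => ?_
  rw [LinearMap.zero_apply, Submodule.mkQ_apply, Submodule.Quotient.mk_eq_zero]
  obtain ⟨i, c, -, rfl⟩ := exists_eq_cosetRep_mul t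
  rw [YetterDrinfeld.inducedMk_mul]
  obtain ⟨a, ha⟩ := hw (ρ c u)
  rw [← ha, map_smul]
  exact Submodule.smul_mem _ _ (Submodule.subset_span ⟨i, rfl⟩)

/-- The basis of `M(x₁, ρ)` given by the coset representatives, for a one-dimensional `ρ`. -/
noncomputable def cosetBasis {w : W} (hw₀ : w ≠ 0) (hw : ∀ u : W, ∃ c : k, c • w = u) :
    Module.Basis Tetra k (V ρ) :=
  Module.Basis.mk ((M ρ).linearIndependent_of_mem_component x_injective
    (fun i => cosetVec_mem_component ρ i w) (cosetVec_ne_zero hw₀)) (span_cosetVec ρ hw).ge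

@[simp]
theorem cosetBasis_apply {w : W} (hw₀ : w ≠ 0) (hw : ∀ u : W, ∃ c : k, c • w = u) (i : Tetra) :
    cosetBasis ρ hw₀ hw i = cosetVec ρ i w := by
  simp [cosetBasis]

/-- The scalars `±1` which normalize the basis such that the cocycle becomes constant. -/
def sign : Tetra → kˣ
  | p1 => 1
  | _ => -1

/-- The normalized basis of `M(x₁, ρ)`. -/
noncomputable def signedBasis {w : W} (hw₀ : w ≠ 0) (hw : ∀ u : W, ∃ c : k, c • w = u) :
    Module.Basis Tetra k (V ρ) :=
  (cosetBasis ρ hw₀ hw).unitsSMul sign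

theorem signedBasis_apply {w : W} (hw₀ : w ≠ 0) (hw : ∀ u : W, ∃ c : k, c • w = u) (i : Tetra) :
    signedBasis ρ hw₀ hw i = (sign i : kˣ) • cosetVec ρ i w := by
  rw [signedBasis, Module.Basis.unitsSMul_apply, cosetBasis_apply]

theorem signedBasis_mem_component {w : W} (hw₀ : w ≠ 0) (hw : ∀ u : W, ∃ c : k, c • w = u)
    (i : Tetra) : signedBasis ρ hw₀ hw i ∈ (M ρ).component (x i) := by
  rw [signedBasis_apply]
  exact Submodule.smul_mem _ _ (cosetVec_mem_component ρ i w)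

variable {ρ} in
theorem action_signedBasis (h₁ : ρ x1 = -1) (h₂ : ρ x4x2 = 1) {w : W} (hw₀ : w ≠ 0)
    (hw : ∀ u : W, ∃ c : k, c • w = u) (i j : Tetra) :
    (M ρ).action (x i) (signedBasis ρ hw₀ hw j) = - signedBasis ρ hw₀ hw (i ◃ j) := by
  have h₁' : ρ x1⁻¹ = -1 := by
    have : ρ x1⁻¹ * ρ x1 = 1 := by rw [← map_mul, inv_mul_cancel, map_one]
    rw [h₁, mul_neg, mul_one] at this
    rw [← this, neg_neg]
  rw [signedBasis_apply, signedBasis_apply, Units.smul_def, map_smul, action_cosetVec]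
  cases i <;> cases j <;> simp [act_table, sign, cocycle, h₁, h₂, h₁', Units.smul_def]

/-! ### Hilbert series and integrals according to the characteristic -/

theorem nicholsAlgebra_of_ringChar_ne_two (hρ : Module.finrank k W = 1) (hk : ringChar k ≠ 2)
    (h₁ : ρ x1 = -1) (h₂ : ρ x4x2 = 1) :
    (M ρ).hilbertSeries = tNumber 2 ^ 2 * tNumber 3 * tNumber 6 ∧
      Module.finrank k (M ρ).NicholsAlgebra = 72 ∧
      ∀ v : Tetra → V ρ, (∀ i, v i ∈ (M ρ).component (x i) ∧ v i ≠ 0) →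
        (M ρ).IsIntegral
          ((M ρ).nicholsMonomial v [.p1, .p2, .p1, .p4, .p2, .p1, .p4, .p2, .p3]) := by
  obtain ⟨w, hw₀, hw⟩ := finrank_eq_one_iff'.1 hρ
  have h2 : (2 : k) ≠ 0 := Ring.two_ne_zero hk
  exact (M ρ).nicholsAlgebra_of_basisWord x_injective (signedBasis ρ hw₀ hw)
    (signedBasis_mem_component ρ hw₀ hw) (action_signedBasis h₁ h₂ hw₀ hw) (n := 6) le_rfl
    (by decide) (SkewAlgebra.linearIndependent_basisWord _ le_rfl (Or.inr h2))
    (SkewAlgebra.span_basisWord _ (by decide) (SkewAlgebra.v4_v2_v1_wordP_mem _))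

theorem nicholsAlgebra_of_ringChar_eq_two (hρ : Module.finrank k W = 1) (hk : ringChar k = 2)
    (h₁ : ρ x1 = -1) (h₂ : ρ x4x2 = 1) :
    (M ρ).hilbertSeries = tNumber 2 ^ 2 * tNumber 3 ^ 2 ∧
      Module.finrank k (M ρ).NicholsAlgebra = 36 ∧
      ∀ v : Tetra → V ρ, (∀ i, v i ∈ (M ρ).component (x i) ∧ v i ≠ 0) →
        (M ρ).IsIntegral ((M ρ).nicholsMonomial v [.p1, .p2, .p1, .p4, .p2, .p3]) := by
  obtain ⟨w, hw₀, hw⟩ := finrank_eq_one_iff'.1 hρ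
  have : CharP k 2 := hk ▸ ringChar.charP k
  rw [pow_two (tNumber 3), ← mul_assoc]
  exact (M ρ).nicholsAlgebra_of_basisWord x_injective (signedBasis ρ hw₀ hw)
    (signedBasis_mem_component ρ hw₀ hw) (action_signedBasis h₁ h₂ hw₀ hw) (n := 3) (by decide)
    (by decide) (SkewAlgebra.linearIndependent_basisWord _ (by decide) (Or.inl le_rfl))
    (SkewAlgebra.span_basisWord _ le_rfl (SkewAlgebra.v4_v2_v1_wordP_mem_of_charP _))

theorem coeff_tNumber (m n : ℕ) : PowerSeries.coeff m (tNumber n) = if m < n then 1 else 0 := by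
  simp [tNumber, PowerSeries.coeff_X_pow]

theorem coeff_two_tNumber : PowerSeries.coeff 2 (tNumber 2 ^ 2 * tNumber 3 * tNumber 6) = 8 ∧
    PowerSeries.coeff 2 (tNumber 2 ^ 2 * tNumber 3 ^ 2) = 8 := by
  simp [pow_two, PowerSeries.coeff_mul, Finset.Nat.sum_antidiagonal_eq_sum_range_succ_mk,
    Finset.sum_range_succ, coeff_tNumber]
  decide

/-- The pairs of vertices for a lower bound of the rank of `1 + c` if `ρ (x₁) ≠ -1`. -/
def pairsOfDiag : Finset (Tetra × Tetra) :=
  -- One pair is removed from each of the four 3-cycles of (i, j) ↦ (i▷j, i); 12 pairs remain.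
  Finset.univ \ {(p1, p2), (p1, p3), (p1, p4), (p2, p3)}

/-- The pairs of vertices for a lower bound of the rank of `1 + c` if `ρ (x₁) = -1`. -/
def pairsOfNondiag : Finset (Tetra × Tetra) :=
  -- The orbit of (2, 3) imposes only 1 - ρ(x₄x₂)³ = 0, which nontrivial cube roots of unity also
  -- satisfy, so one of its pairs is dropped; 11 pairs remain.
  Finset.univ \ {(p1, p1), (p2, p2), (p3, p3), (p4, p4), (p2, p3)}

theorem finrank_nicholsPart_two_le_iff (hρ : Module.finrank k W = 1) :
    Module.finrank k ((M ρ).nicholsPart 2) ≤ 10 ↔ ρ x1 = -1 ∧ ρ x4x2 = 1 := by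
  constructor
  · intro h
    obtain ⟨w, hw₀, hw⟩ := finrank_eq_one_iff'.1 hρ
    have hs : ∀ c, ∃ a : k, ρ c = a • (1 : Module.End k W) := by
      intro c
      obtain ⟨a, ha⟩ := hw (ρ c w)
      refine ⟨a, LinearMap.ext fun u => ?_⟩
      obtain ⟨b, rfl⟩ := hw u
      simp [← ha]
    choose χ hχ using hs
    have hχ1 : χ 1 = 1 := by
      have := LinearMap.congr_fun (hχ 1) w
      rw [map_one] at this
      exact (smul_left_injective k hw₀ (by simpa using this)).symm
    have ha : ∀ i j, (M ρ).action (x i) (cosetBasis ρ hw₀ hw j) =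
        χ (cocycle i j) • cosetBasis ρ hw₀ hw (i ◃ j) := by
      intro i j
      rw [cosetBasis_apply, cosetBasis_apply, action_cosetVec, hχ]
      simp
    have key := (M ρ).card_le_finrank_nicholsPart_two x_injective (cosetBasis ρ hw₀ hw)
      (fun i => by rw [cosetBasis_apply]; exact cosetVec_mem_component ρ i w) _ ha
    have hx1 : χ x1 = -1 := by
      by_contra hne
      have hne' : 1 + χ x1 ≠ 0 := fun h => hne (eq_neg_of_add_eq_zero_right h)
      have := key pairsOfDiag fun c hc hr => by
        have h12 := hc (p1, p2) (by decide)
        have h13 := hc (p1, p3) (by decide)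
        have h14 := hc (p1, p4) (by decide)
        have h23 := hc (p2, p3) (by decide)
        have hd : ∀ i, c (i, i) = 0 := fun i => by
          have h := hr i i
          have hi : i ◃ i = i ∧ cocycle i i = x1 := by cases i <;> simp [act_table, cocycle]
          rw [hi.1, hi.2, ← one_add_mul] at h
          exact (mul_eq_zero.1 h).resolve_left hne'
        have h41 := hr p1 p2
        have h24 := hr p4 p1
        have h31 := hr p1 p4
        have h43 := hr p3 p1
        have h21 := hr p1 p3
        have h32 := hr p2 p1
        have h42 := hr p2 p3
        have h34 := hr p4 p2
        simp only [act_table] at h41 h24 h31 h43 h21 h32 h42 h34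
        simp only [h12, h13, h14, h23, mul_zero, add_zero] at h41 h31 h21 h42
        simp only [h41, h31, h21, h42, mul_zero, add_zero] at h24 h43 h32 h34
        ext ⟨i, j⟩
        cases i <;> cases j <;> first | exact hd _ | assumption
      have hcard : pairsOfDiag.card = 12 := by decide
      omega
    have hx42 : χ x4x2 = 1 := by
      by_contra hne
      have hne' : 1 - χ x4x2 ≠ 0 := sub_ne_zero.2 (Ne.symm hne)
      have := key pairsOfNondiag fun c hc hr => by
        have hd : ∀ i, c (i, i) = 0 := fun i => hc (i, i) (by cases i <;> decide)
        have h23 := hc (p2, p3) (by decide)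
        have h41 := hr p1 p2
        have h24 := hr p4 p1
        have h12 := hr p2 p4
        have h31 := hr p1 p4
        have h43 := hr p3 p1
        have h14 := hr p4 p3
        have h21 := hr p1 p3
        have h32 := hr p2 p1
        have h13 := hr p3 p2
        have h42 := hr p2 p3
        have h34 := hr p4 p2
        simp only [act_table, cocycle, hx1, hχ1, h23, mul_zero, add_zero]
          at h41 h24 h12 h31 h43 h14 h21 h32 h13 h42 h34
        -- Going once around the 3-cycle of (1, 2) multiplies the coefficient by χ(x₄x₂). The same
        -- holds for (1, 4) and (1, 3).
        have e12 : c (p1, p2) = 0 := (mul_eq_zero.1 (show (1 - χ x4x2) * c (p1, p2) = 0 by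
          linear_combination h12 - χ x4x2 * h24 + χ x4x2 * h41)).resolve_left hne'
        have e14 : c (p1, p4) = 0 := (mul_eq_zero.1 (show (1 - χ x4x2) * c (p1, p4) = 0 by
          linear_combination h14 - χ x4x2 * h43 + χ x4x2 * h31)).resolve_left hne'
        have e13 : c (p1, p3) = 0 := (mul_eq_zero.1 (show (1 - χ x4x2) * c (p1, p3) = 0 by
          linear_combination h13 - χ x4x2 * h32 + χ x4x2 * h21)).resolve_left hne'
        simp only [e12, e13, e14, mul_zero, add_zero] at h41 h31 h21
        simp only [h41, h31, h21, h42, mul_zero, add_zero] at h24 h43 h32 h34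
        ext ⟨i, j⟩
        cases i <;> cases j <;> first | exact hd _ | assumption
      have hcard : pairsOfNondiag.card = 11 := by decide
      omega
    exact ⟨by rw [hχ, hx1]; simp, by rw [hχ, hx42]; simp⟩
  · rintro ⟨h₁, h₂⟩
    have h8 : Module.finrank k ((M ρ).nicholsPart 2) = PowerSeries.coeff 2 (M ρ).hilbertSeries := by
      rw [YetterDrinfeld.hilbertSeries, PowerSeries.coeff_mk]
    rw [h8]
    by_cases hk : ringChar k = 2
    · rw [(nicholsAlgebra_of_ringChar_eq_two ρ hρ hk h₁ h₂).1, coeff_two_tNumber.2]; decide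
    · rw [(nicholsAlgebra_of_ringChar_ne_two ρ hρ hk h₁ h₂).1, coeff_two_tNumber.1]; decide

end Tetra

theorem proposition5 {k : Type u} [Field k] {W : Type w} [AddCommGroup W] [Module k W]
    (ρ : Representation k Tetra.C W) (hρ : ρ.IsAbsolutelySimple) :
    (Module.finrank k W = 1 ∧
      Module.finrank k (Tetra.V ρ) = 4 ∧
      (Module.finrank k ((Tetra.M ρ).nicholsPart 2) ≤
          Module.finrank k (Tetra.V ρ) * (Module.finrank k (Tetra.V ρ) + 1) / 2 ↔
        ρ Tetra.x1 = -1 ∧ ρ Tetra.x4x2 = 1)) ∧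
    (ringChar k ≠ 2 → ρ Tetra.x1 = -1 → ρ Tetra.x4x2 = 1 →
      (Tetra.M ρ).hilbertSeries = tNumber 2 ^ 2 * tNumber 3 * tNumber 6 ∧
      Module.finrank k (Tetra.M ρ).NicholsAlgebra = 72 ∧
      ∀ v : Tetra → Tetra.V ρ,
        (∀ i, v i ∈ (Tetra.M ρ).component (Tetra.x i) ∧ v i ≠ 0) →
        (Tetra.M ρ).IsIntegral
          ((Tetra.M ρ).nicholsMonomial v [.p1, .p2, .p1, .p4, .p2, .p1, .p4, .p2, .p3])) ∧
    (ringChar k = 2 → ρ Tetra.x1 = -1 → ρ Tetra.x4x2 = 1 →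
      (Tetra.M ρ).hilbertSeries = tNumber 2 ^ 2 * tNumber 3 ^ 2 ∧
      Module.finrank k (Tetra.M ρ).NicholsAlgebra = 36 ∧
      ∀ v : Tetra → Tetra.V ρ,
        (∀ i, v i ∈ (Tetra.M ρ).component (Tetra.x i) ∧ v i ≠ 0) →
        (Tetra.M ρ).IsIntegral
          ((Tetra.M ρ).nicholsMonomial v [.p1, .p2, .p1, .p4, .p2, .p3])) := by
  have hW : Module.finrank k W = 1 := hρ.finrank_eq_one Tetra.C_mul_comm
  have hV : Module.finrank k (Tetra.V ρ) = 4 := by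
    obtain ⟨w, hw₀, hw⟩ := finrank_eq_one_iff'.1 hW
    rw [Module.finrank_eq_card_basis (Tetra.cosetBasis ρ hw₀ hw)]
    rfl
  refine ⟨⟨hW, hV, ?_⟩, fun hk h₁ h₂ => Tetra.nicholsAlgebra_of_ringChar_ne_two ρ hW hk h₁ h₂,
    fun hk h₁ h₂ => Tetra.nicholsAlgebra_of_ringChar_eq_two ρ hW hk h₁ h₂⟩
  rw [hV]
  exact Tetra.finrank_nicholsPart_two_le_iff ρ hW
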